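/- Consider the Bell scenario with two parties, $18$ settings per party and outcomes $0,1$. A behaviour is written in Collins--Gisin coordinates as the point $p=\big(P(\Pi^A_x=1),\,P(\Pi^B_y=1),\,P(\Pi^A_x=\Pi^B_y=1)\big)_{x,y}\in\mathbb{R}^{360}$. Let $$v_1,\dots,v_{18}=(0,0,0,1),(0,0,1,0),(0,1,0,0),(1,-1,-1,1),(1,1,1,1),(1,-1,1,-1),(1,1,-1,1),(-1,1,1,1),(1,1,1,-1),$$ $$(1,0,0,1),(1,0,0,-1),(0,1,-1,0),(1,0,-1,0),(0,1,0,-1),(1,0,1,0),(1,-1,0,0),(1,1,0,0),(0,0,1,1)$$ be the vectors of the Kochen--Specker set KS18 and let $\Pi_i$ be the orthogonal projector of $\mathbb{C}^4$ onto $\mathbb{C}v_i$. The KS18 correlations $p_{\mathrm{KS18}}$ are the behaviour obtained when both parties measure $\Pi_1,\dots,\Pi_{18}$ on the maximally entangled state $\frac{1}{\sqrt4}\sum_{j=1}^4|jj\rangle$. Put $$I^{t}_{\mathrm{KS18}}(p)=\sum_{x,y=1}^{18}c_{xy}\,P(\Pi^A_x=\Pi^B_y=1),$$ where $c$ is the symmetric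 matrix with $c_{xy}=-2$ if $x\neq y$ and $v_x\perp v_y$; $c_{xy}=0$ if $x=y$ or if $\{x,y\}$ is one of the $36$ pairs $\{1,4\},\{1,5\},\{1,8\},\{1,9\},\{2,5\},\{2,6\},\{2,7\},\{2,8\},\{3,4\},\{3,6\},\{3,7\},\{3,9\},\{4,7\},\{4,8\},\{5,7\},\{5,9\},\{6,8\},\{6,9\},$ $\{10,13\},\{10,14\},\{10,17\},\{10,18\},\{11,14\},\{11,15\},\{11,16\},\{11,18\},\{12,13\},\{12,15\},\{12,16\},\{12,17\},\{13,16\},\{13,18\},\{14,16\},\{14,17\},\{15,17\},\{15,18\}$; and $c_{xy}=1$ otherwise. The quantum set $Q\subset\mathbb{R}^{360}$ is the set of behaviours obtained from a (pure or mixed) shared state and two-outcome measurements (POVMs) on complex Hilbert spaces; the statement holds for each of its three usual versions: tensor products of finite-dimensional spaces, tensor products of spaces of arbitrary dimension, and commuting measurement operators on one space of arbitrary dimension. Then: 1. The maximum of $I^t_{\mathrm{KS18}}$ over the level $1+AB$ of the Navascués--Pironio--Acín hierarchy (the behaviours that extend to a positive semidefinite moment matrix indexed by $1$, $A_x$, $B_y$,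 $A_xB_y$) is exactly $45/4$. 2. $p_{\mathrm{KS18}}\in Q$, $I^t_{\mathrm{KS18}}(p_{\mathrm{KS18}})=45/4$, and the maximum of $I^t_{\mathrm{KS18}}$ over $Q$ equals $45/4$. 3. $p_{\mathrm{KS18}}$ lies on the boundary of $Q$ in $\mathbb{R}^{360}$, and it is extremal, that is, an extreme point of $Q$. -/

import Mathlib

open scoped TensorProduct Kronecker ComplexOrder

universe u

noncomputable section

namespace KS18

/-! ### Behaviours and Bell functionals in the (2,18,2) Bell scenario -/

/-- A behaviour of the (2,18,2) scenario in Collins-Gisin coordinates, a point of `ℝ^360`: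
`p.1 x` is the probability that Alice gets outcome 1 for setting `x`, `p.2.1 y` the probability
that Bob gets outcome 1 for setting `y`, and `p.2.2 x y` the probability that both get outcome 1
for settings `x`, `y`. The settings `1, ..., 18` are indexed by `0, ..., 17`. -/
abbrev Behavior : Type := (Fin 18 → ℝ) × (Fin 18 → ℝ) × (Fin 18 → Fin 18 → ℝ)

/-- The Bell functional with marginal coefficients `cA`, `cB` and joint coefficients `c`;
the rows of `c` are the settings of Bob, its columns the settings of Alice. -/
def bellValue (cA cB : Fin 18 → ℝ) (c : Matrix (Fin 18) (Fin 18) ℝ) (p : Behavior) : ℝ :=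
  ∑ x, ∑ y, c y x * p.2.2 x y + ∑ x, cA x * p.1 x + ∑ y, cB y * p.2.1 y

/-- The symmetric pattern of joint coefficients shared by the Bell operators for KS18. -/
def coeffPattern (a b c d e f : ℤ) : Matrix (Fin 18) (Fin 18) ℤ :=
  !![
    f, a, a, d, d, c, c, d, d, c, c, e, b, c, b, b, b, c;
    a, f, a, c, d, d, d, d, c, b, b, c, c, e, c, b, b, c;
    a, a, f, d, c, d, d, c, d, b, b, c, b, c, b, c, c, e;
    d, c, d, f, a, a, d, d, c, c, b, b, c, c, e, c, b, b;
    d, d, c, a, f, a, d, c, d, c, b, b, b, b, c, e, c, c;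
    c, d, d, a, a, f, c, d, d, e, c, c, b, b, c, c, b, b;
    c, d, d, d, d, c, f, a, a, c, e, c, c, b, b, b, c, b;
    d, d, c, d, c, d, a, f, a, b, c, b, c, b, b, c, e, c;
    d, c, d, c, d, d, a, a, f, b, c, b, e, c, c, b, c, b;
    c, b, b, c, c, e, c, b, b, f, a, a, d, d, c, c, d, d;
    c, b, b, b, b, c, e, c, c, a, f, a, c, d, d, d, c, d;
    e, c, c, b, b, c, c, b, b, a, a, f, d, c, d, d, d, c;
    b, c, b, c, b, b, c, c, e, d, c, d, f, a, a, d, c, d;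
    c, e, c, c, b, b, b, b, c, d, d, c, a, f, a, d, d, c;
    b, c, b, e, c, c, b, b, c, c, d, d, a, a, f, c, d, d;
    b, b, c, c, e, c, b, c, b, c, d, d, d, d, c, f, a, a;
    b, b, c, b, c, b, c, e, c, d, c, d, c, d, d, a, f, a;
    c, c, e, b, c, b, b, c, b, d, d, c, d, c, d, a, a, f]

/-- The tight Bell operator: `a = b = e = -2`, `c = 1`, `d = f = 0`, and vanishing marginal
coefficients. -/
def bellT (p : Behavior) : ℝ :=
  bellValue 0 0 ((coeffPattern (-2) (-2) 1 0 (-2) 0).map (Int.cast : ℤ → ℝ)) p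

/-! ### The KS18 correlations -/

/-- The (unnormalized) vectors of the Kochen-Specker set KS18, labelled so that `v_i ⟂ v_j`
exactly where the coefficient pattern has an entry `a`, `b` or `e`. -/
def ksVec : Fin 18 → Fin 4 → ℤ :=
  ![![0, 0, 0, 1], ![0, 0, 1, 0], ![0, 1, 0, 0],
    ![1, -1, -1, 1], ![1, 1, 1, 1], ![1, -1, 1, -1],
    ![1, 1, -1, 1], ![-1, 1, 1, 1], ![1, 1, 1, -1],
    ![1, 0, 0, 1], ![1, 0, 0, -1], ![0, 1, -1, 0],
    ![1, 0, -1, 0], ![0, 1, 0, -1], ![1, 0, 1, 0],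
    ![1, -1, 0, 0], ![1, 1, 0, 0], ![0, 0, 1, 1]]

/-- The rank-one projector onto the line spanned by the `i`-th vector. -/
def ksProj (i : Fin 18) : Matrix (Fin 4) (Fin 4) ℂ :=
  Matrix.of fun s t => ((ksVec i s * ksVec i t : ℤ) : ℂ) / ((∑ r, ksVec i r ^ 2 : ℤ) : ℂ)

/-- The maximally entangled state `(1/√4) ∑ j, |j j⟩` of two ququarts. -/
def maxEnt : Fin 4 × Fin 4 → ℂ := fun s => if s.1 = s.2 then 1 / 2 else 0

/-- The quantum expectation `⟨ψ| M |ψ⟩` in the maximally entangled state. -/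
def maxEntExpect (M : Matrix (Fin 4 × Fin 4) (Fin 4 × Fin 4) ℂ) : ℝ :=
  (star maxEnt ⬝ᵥ M.mulVec maxEnt).re

/-- The KS18 correlations: both parties measure the 18 projectors on the maximally entangled
state of two ququarts. -/
def ksBehavior : Behavior :=
  (fun x => maxEntExpect (ksProj x ⊗ₖ (1 : Matrix (Fin 4) (Fin 4) ℂ)),
   fun y => maxEntExpect ((1 : Matrix (Fin 4) (Fin 4) ℂ) ⊗ₖ ksProj y),
   fun x y => maxEntExpect (ksProj x ⊗ₖ ksProj y))

/-! ### Quantum behaviours -/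

/-- A density operator `ρ = ∑ k, |v_k⟩⟨v_k|` of trace one, given through such a decomposition;
it is pure if only one of the vectors is nonzero. -/
structure DensityOp (H : Type*) [NormedAddCommGroup H] [InnerProductSpace ℂ H] where
  vec : ℕ → H
  trace_one : HasSum (fun k => ‖vec k‖ ^ 2) 1

/-- The expectation `tr (ρ T) = ∑ k, ⟨v_k, T v_k⟩`. -/
def DensityOp.expect {H : Type*} [NormedAddCommGroup H] [InnerProductSpace ℂ H]
    (ρ : DensityOp H) (T : H →L[ℂ] H) : ℂ :=
  ∑' k, inner ℂ (ρ.vec k) (T (ρ.vec k))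

/-- `E` is an effect, that is, `(E, 1 - E)` is a two-outcome measurement (POVM); `E` is the
element of outcome 1. -/
def IsEffect {H : Type*} [NormedAddCommGroup H] [InnerProductSpace ℂ H] (E : H →L[ℂ] H) : Prop :=
  E.IsPositive ∧ (1 - E).IsPositive

/-- The Hilbert space tensor product, that is, the completion of the algebraic one. -/
abbrev HilbertTensor (H K : Type*) [NormedAddCommGroup H] [InnerProductSpace ℂ H]
    [NormedAddCommGroup K] [InnerProductSpace ℂ K] : Type _ :=
  UniformSpace.Completion (H ⊗[ℂ] K)

/-- The operator `E ⊗ F` on the Hilbert space tensor product. -/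
def opTensor {H K : Type*} [NormedAddCommGroup H] [InnerProductSpace ℂ H]
    [NormedAddCommGroup K] [InnerProductSpace ℂ K] (E : H →L[ℂ] H) (F : K →L[ℂ] K) :
    HilbertTensor H K →L[ℂ] HilbertTensor H K :=
  (TensorProduct.mapL E F).completion

/-- A quantum strategy of two spatially separated parties: Hilbert spaces of arbitrary dimension,
a shared state on their tensor product, and 18 two-outcome measurements for each party. -/
structure TensorStrategy (H K : Type*) [NormedAddCommGroup H] [InnerProductSpace ℂ H]
    [NormedAddCommGroup K] [InnerProductSpace ℂ K] where
  state : DensityOp (HilbertTensor H K)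
  alice : Fin 18 → H →L[ℂ] H
  bob : Fin 18 → K →L[ℂ] K
  alice_effect : ∀ x, IsEffect (alice x)
  bob_effect : ∀ y, IsEffect (bob y)

/-- The behaviour produced by a tensor product strategy (Born rule). -/
def TensorStrategy.behavior {H K : Type*} [NormedAddCommGroup H] [InnerProductSpace ℂ H]
    [NormedAddCommGroup K] [InnerProductSpace ℂ K] (S : TensorStrategy H K) : Behavior :=
  (fun x => (S.state.expect (opTensor (S.alice x) 1)).re,
   fun y => (S.state.expect (opTensor 1 (S.bob y))).re,
   fun x y => (S.state.expect (opTensor (S.alice x) (S.bob y))).re)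

/-- A quantum strategy in the commuting operator model: one Hilbert space of arbitrary dimension,
on which the measurement operators of Alice commute with those of Bob. -/
structure CommutingStrategy (H : Type*) [NormedAddCommGroup H] [InnerProductSpace ℂ H] where
  state : DensityOp H
  alice : Fin 18 → H →L[ℂ] H
  bob : Fin 18 → H →L[ℂ] H
  alice_effect : ∀ x, IsEffect (alice x)
  bob_effect : ∀ y, IsEffect (bob y)
  commute : ∀ x y, Commute (alice x) (bob y)

/-- The behaviour produced by a commuting operator strategy (Born rule). -/
def CommutingStrategy.behavior {H : Type*} [NormedAddCommGroup H] [InnerProductSpace ℂ H]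
    (S : CommutingStrategy H) : Behavior :=
  (fun x => (S.state.expect (S.alice x)).re,
   fun y => (S.state.expect (S.bob y)).re,
   fun x y => (S.state.expect (S.alice x * S.bob y)).re)

/-- The quantum set of finite-dimensional tensor product strategies. -/
def finiteQuantumSet : Set Behavior :=
  {p | ∃ (H K : Type u) (_ : NormedAddCommGroup H) (_ : InnerProductSpace ℂ H)
    (_ : NormedAddCommGroup K) (_ : InnerProductSpace ℂ K)
    (_ : FiniteDimensional ℂ H) (_ : FiniteDimensional ℂ K)
    (S : TensorStrategy H K), S.behavior = p}

/-- The quantum set of tensor product strategies on Hilbert spaces of arbitrary dimension. -/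
def tensorQuantumSet : Set Behavior :=
  {p | ∃ (H K : Type u) (_ : NormedAddCommGroup H) (_ : InnerProductSpace ℂ H)
    (_ : NormedAddCommGroup K) (_ : InnerProductSpace ℂ K)
    (_ : CompleteSpace H) (_ : CompleteSpace K)
    (S : TensorStrategy H K), S.behavior = p}

/-- The quantum set of commuting operator strategies on Hilbert spaces of arbitrary dimension. -/
def commutingQuantumSet : Set Behavior :=
  {p | ∃ (H : Type u) (_ : NormedAddCommGroup H) (_ : InnerProductSpace ℂ H)
    (_ : CompleteSpace H) (S : CommutingStrategy H), S.behavior = p}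

/-! ### The Navascués-Pironio-Acín hierarchy at level 1+AB -/

/-- The operator products that index the moment matrix at level 1+AB: `1`, `A_x`, `B_y` and
`A_x B_y`, encoded as pairs (factor of Alice or none, factor of Bob or none). -/
abbrev NPAIndex : Type := Option (Fin 18) × Option (Fin 18)

/-- The reduced word of the product of (the adjoint of) `s` and `t`, where `s` and `t` are the
identity or a projector of one and the same party: equal neighbours are merged, since `P² = P`. -/
def redWord (s t : Option (Fin 18)) : List (Fin 18) :=
  (s.toList ++ t.toList).destutter (· ≠ ·)

/-- The set of behaviours admitted by the hierarchy at level 1+AB. A moment `m (w, w')` is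
assigned to each product of a reduced word `w` in the projectors of Alice and a reduced word `w'`
in the projectors of Bob; the entry of the moment matrix at `(u, v)` is the moment of `u† v`, so
that entries which agree by `P² = P` and by the commutation of the parties are equal. -/
def npaSet : Set Behavior :=
  {p | ∃ m : List (Fin 18) × List (Fin 18) → ℂ,
    (Matrix.of fun u v : NPAIndex => m (redWord u.1 v.1, redWord u.2 v.2)).PosSemidef ∧
    m ([], []) = 1 ∧
    (∀ x, m ([x], []) = (p.1 x : ℂ)) ∧
    (∀ y, m ([], [y]) = (p.2.1 y : ℂ)) ∧
    (∀ x y, m ([x], [y]) = (p.2.2 x y : ℂ))}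

end KS18

end

/-!
The vectors of KS18 are the flags of a `3 × 3` grid: a line (row or column) together with one of its
points. The nine orthogonal bases belong to the nine points; the basis at a point consists of the
flags of the two lines through it whose point is a different one (`ksBasis`).

*The bound.* Since joint probabilities are nonnegative, the coefficients of some orthogonal pairs can
be raised from `-2` to `-1` (`relaxedCoeff`). The resulting symmetric matrix `c` satisfies `c² = 25`
and has row sums `-5`, hence for projectors `A x`, `B y` acting on a vector `ψ`
`10 (45/4 - ∑ c x y ⟪A x ψ, B y ψ⟫) = ∑ x, ‖5/2 ψ + ∑ y, c x y B y ψ - 5 A x ψ‖²`.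
This only uses inner products that are entries of the moment matrix, so it bounds `bellT` on
`npaSet` (`bellT_le_of_mem_npaSet`). Every quantum set lies in `npaSet`: for effects `E` that are not
projections, the excess `E - E²` on the diagonal of the moment matrix is again positive and commutes
with the other party (`commutingQuantumSet_subset_npaSet`). The KS18 correlations reach the bound,
so they maximize a nonzero linear functional and lie on the boundary.

*Extremality.* The correlations satisfy `P(A x = 1) = P(B x = 1) = P(A x = B x = 1)`,
`P(A x = B y = 1) = 0` for orthogonal vectors, and the marginals of a basis sum to one. Each of
these is the equality case of an inequality on the quantum set, so the endpoints of a segment through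
`ksBehavior` satisfy them as well. For a strategy with these properties, `A x` acts on each vector of
the state like `B x`. Hence the operators of Alice satisfy the relations of the 18 projectors on the
orbit of this vector under their commutant, and the vector induces a trace on them (`ks_rigidity`).
The sums of two projectors of a line give a Mermin-Peres magic square of `±1`-valued observables.
Entries of a magic square in general position anticommute, so under a trace the nine entries are
traceless and orthonormal; as the projectors are linear combinations of `1` and of these entries,
all correlations are determined (`ks_trace`).
-/

noncomputable section

namespace KS18

/-! ### The bound at level 1+AB -/

/-- The coefficients of a relaxation of `bellT` which penalizes the orthogonal pairs of the classes
`a` and `e` with `-1` instead of `-2`. -/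
def relaxedCoeff : Matrix (Fin 18) (Fin 18) ℤ := coeffPattern (-1) (-2) 1 0 (-1) 0

lemma relaxedCoeff_mul_self (y z : Fin 18) :
    ∑ x, relaxedCoeff y x * relaxedCoeff z x = if y = z then 25 else 0 := by
  revert y z
  decide +kernel

lemma relaxedCoeff_sum (y : Fin 18) : ∑ x, relaxedCoeff y x = -5 := by
  revert y
  decide +kernel

lemma coeff_le_relaxedCoeff (y x : Fin 18) :
    coeffPattern (-2) (-2) 1 0 (-2) 0 y x ≤ relaxedCoeff y x := by
  have h : ∀ i j : Fin 18, 0 ≤ relaxedCoeff i j - coeffPattern (-2) (-2) 1 0 (-2) 0 i j := by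
    decide +kernel
  exact sub_nonneg.1 (h y x)

open RealInnerProductSpace in
/-- The sum-of-squares certificate: since the coefficient matrix squares to `25` and has row sums
`-5`, ten times the gap `45 / 4 - ∑ c x y ⟪a x, b y⟫` is
`∑ x, ‖5/2 ψ + ∑ y, c x y b y - 5 a x‖²`. -/
lemma relaxed_bound {V : Type*} [NormedAddCommGroup V] [InnerProductSpace ℝ V]
    (ψ : V) (a b : Fin 18 → V) (hψ : ⟪ψ, ψ⟫ = 1)
    (ha : ∀ x, ⟪ψ, a x⟫ = ⟪a x, a x⟫) (hb : ∀ y, ⟪ψ, b y⟫ = ⟪b y, b y⟫) :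
    ∑ x, ∑ y, (relaxedCoeff y x : ℝ) * ⟪a x, b y⟫ ≤ 45 / 4 := by
  set T : Fin 18 → V := fun x => ∑ y, (relaxedCoeff y x : ℝ) • b y with hT
  have h1 : ∀ x, ⟪a x, T x⟫ = ∑ y, (relaxedCoeff y x : ℝ) * ⟪a x, b y⟫ := fun x => by
    simp [hT, inner_sum, real_inner_smul_right]
  have h2 : ∑ x, ⟪ψ, T x⟫ = -5 * ∑ y, ⟪b y, b y⟫ := by
    simp only [hT, inner_sum, real_inner_smul_right, hb]
    rw [Finset.sum_comm, Finset.mul_sum]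
    refine Finset.sum_congr rfl fun y _ => ?_
    rw [← Finset.sum_mul]
    congr 1
    exact_mod_cast relaxedCoeff_sum y
  have h3 : ∑ x, ⟪T x, T x⟫ = 25 * ∑ y, ⟪b y, b y⟫ := by
    simp only [hT, inner_sum, sum_inner, real_inner_smul_right, real_inner_smul_left]
    rw [Finset.sum_comm, Finset.mul_sum]
    refine Finset.sum_congr rfl fun y _ => ?_
    rw [Finset.sum_comm]
    calc ∑ z, ∑ x, (relaxedCoeff y x : ℝ) * ((relaxedCoeff z x : ℝ) * ⟪b z, b y⟫)
        = ∑ z, (if y = z then (25 : ℝ) else 0) * ⟪b z, b y⟫ := by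
          refine Finset.sum_congr rfl fun z _ => ?_
          simp only [← mul_assoc]
          rw [← Finset.sum_mul]
          congr 1
          exact_mod_cast relaxedCoeff_mul_self y z
      _ = 25 * ⟪b y, b y⟫ := by simp
  have h4 : ∀ x, ⟪(5 / 2 : ℝ) • ψ + T x - (5 : ℝ) • a x, (5 / 2 : ℝ) • ψ + T x - (5 : ℝ) • a x⟫
      = 25 / 4 + ⟪T x, T x⟫ + 5 * ⟪ψ, T x⟫ - 10 * ⟪a x, T x⟫ := fun x => by
    simp only [inner_sub_left, inner_sub_right, inner_add_left, inner_add_right,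
      real_inner_smul_left, real_inner_smul_right, hψ]
    rw [real_inner_comm ψ (T x), real_inner_comm (a x) (T x), real_inner_comm ψ (a x), ← ha x]
    ring
  have h5 : 0 ≤ ∑ x, ⟪(5 / 2 : ℝ) • ψ + T x - (5 : ℝ) • a x,
      (5 / 2 : ℝ) • ψ + T x - (5 : ℝ) • a x⟫ := Finset.sum_nonneg fun x _ => real_inner_self_nonneg
  simp only [h4, Finset.sum_add_distrib, Finset.sum_sub_distrib, ← Finset.mul_sum, h2, h3] at h5
  simp only [← h1]
  simp at h5
  linarith

/-- A positive semidefinite matrix is a Gram matrix. -/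
lemma exists_gram {ι : Type*} [Fintype ι] {M : Matrix ι ι ℂ} (hM : M.PosSemidef) :
    ∃ (n : ℕ) (g : ι → EuclideanSpace ℂ (Fin n)), ∀ u v, inner ℂ (g u) (g v) = M u v := by
  obtain ⟨n, v, rfl⟩ := Matrix.posSemidef_iff_eq_sum_vecMulVec.1 hM
  refine ⟨n, fun u => WithLp.toLp 2 fun i => star (v i u), fun u w => ?_⟩
  simp [PiLp.inner_apply, Matrix.sum_apply, Matrix.vecMulVec_apply, mul_comm]

theorem bellT_le_of_mem_npaSet {p : Behavior} (hp : p ∈ npaSet) : bellT p ≤ 45 / 4 := by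
  obtain ⟨m, hM, h0, hA, hB, hAB⟩ := hp
  obtain ⟨n, g, hg⟩ := exists_gram hM
  simp only [Matrix.of_apply] at hg
  let _ : InnerProductSpace ℝ (EuclideanSpace ℂ (Fin n)) := InnerProductSpace.complexToReal
  have hre : ∀ x y : EuclideanSpace ℂ (Fin n), inner ℝ x y = (inner ℂ x y).re := fun _ _ => rfl
  have key := relaxed_bound (g (none, none)) (fun x => g (some x, none)) (fun y => g (none, some y))
    (by simp only [hre, hg]; simp [redWord, h0])
    (fun x => by simp only [hre, hg]; simp [redWord])
    (fun y => by simp only [hre, hg]; simp [redWord])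
  simp only [hre, hg] at key
  -- joint probabilities are diagonal entries of the moment matrix, as `P² = P`
  have hpos : ∀ x y, 0 ≤ p.2.2 x y := fun x y => by
    have h := inner_self_nonneg (𝕜 := ℂ) (x := g (some x, some y))
    rw [hg] at h
    simpa [redWord, hAB] using h
  refine le_trans ?_ key
  simp only [bellT, bellValue, Pi.zero_apply, zero_mul, Finset.sum_const_zero, add_zero]
  refine Finset.sum_le_sum fun x _ => Finset.sum_le_sum fun y _ => ?_
  have h : m (redWord (some x) none, redWord none (some y)) = p.2.2 x y := by
    simpa [redWord] using hAB x y
  simp only [h, Complex.ofReal_re, Matrix.map_apply]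
  exact mul_le_mul_of_nonneg_right (by exact_mod_cast coeff_le_relaxedCoeff y x) (hpos x y)

/-! ### Expectations in a state -/

namespace DensityOp

variable {H : Type*} [NormedAddCommGroup H] [InnerProductSpace ℂ H] (ρ : DensityOp H)

lemma summable_inner (T : H →L[ℂ] H) :
    Summable fun k => inner ℂ (ρ.vec k) (T (ρ.vec k)) := by
  refine Summable.of_norm_bounded (g := fun k => ‖T‖ * ‖ρ.vec k‖ ^ 2)
    (ρ.trace_one.summable.mul_left _) fun k => ?_
  calc ‖inner ℂ (ρ.vec k) (T (ρ.vec k))‖ ≤ ‖ρ.vec k‖ * ‖T (ρ.vec k)‖ := norm_inner_le_norm _ _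
    _ ≤ ‖ρ.vec k‖ * (‖T‖ * ‖ρ.vec k‖) := by gcongr; exact T.le_opNorm _
    _ = ‖T‖ * ‖ρ.vec k‖ ^ 2 := by ring

lemma expect_one : ρ.expect 1 = 1 := by
  have h := (Complex.hasSum_ofReal.2 ρ.trace_one).tsum_eq
  simpa [expect, inner_self_eq_norm_sq_to_K] using h

lemma expect_smul (c : ℂ) (T : H →L[ℂ] H) : ρ.expect (c • T) = c * ρ.expect T := by
  simp only [expect, _root_.smul_apply, inner_smul_right]
  exact tsum_mul_left

lemma expect_sub (S T : H →L[ℂ] H) : ρ.expect (S - T) = ρ.expect S - ρ.expect T := by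
  simp only [expect, _root_.sub_apply, inner_sub_right]
  exact (ρ.summable_inner S).tsum_sub (ρ.summable_inner T)

lemma expect_sum {ι : Type*} (s : Finset ι) (T : ι → H →L[ℂ] H) :
    ρ.expect (∑ i ∈ s, T i) = ∑ i ∈ s, ρ.expect (T i) := by
  simp only [expect, _root_.sum_apply, inner_sum]
  exact Summable.tsum_finsetSum fun i _ => ρ.summable_inner (T i)

lemma re_expect (T : H →L[ℂ] H) :
    (ρ.expect T).re = ∑' k, (inner ℂ (ρ.vec k) (T (ρ.vec k))).re :=
  Complex.re_tsum (ρ.summable_inner T)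

lemma summable_re_inner (T : H →L[ℂ] H) :
    Summable fun k => (inner ℂ (ρ.vec k) (T (ρ.vec k))).re :=
  Complex.reCLM.summable (ρ.summable_inner T)

lemma re_expect_nonneg {T : H →L[ℂ] H}
    (hT : ∀ k, 0 ≤ (inner ℂ (ρ.vec k) (T (ρ.vec k))).re) : 0 ≤ (ρ.expect T).re := by
  rw [re_expect]
  exact tsum_nonneg hT

/-- A vanishing expectation of nonnegative terms vanishes on each vector of the decomposition. -/
lemma re_inner_eq_zero {T : H →L[ℂ] H}
    (hT : ∀ k, 0 ≤ (inner ℂ (ρ.vec k) (T (ρ.vec k))).re) (h0 : (ρ.expect T).re = 0) (k : ℕ) :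
    (inner ℂ (ρ.vec k) (T (ρ.vec k))).re = 0 := by
  rw [re_expect, ← (ρ.summable_re_inner T).hasSum_iff,
    hasSum_zero_iff_of_nonneg hT] at h0
  exact congrFun h0 k

variable [CompleteSpace H]

lemma expect_star (T : H →L[ℂ] H) : ρ.expect (star T) = star (ρ.expect T) := by
  simp only [expect]
  rw [← starRingEnd_apply, Complex.conj_tsum]
  refine tsum_congr fun k => ?_
  rw [ContinuousLinearMap.star_eq_adjoint, ContinuousLinearMap.adjoint_inner_right,
    inner_conj_symm]

lemma ofReal_re_expect {T : H →L[ℂ] H} (hT : IsSelfAdjoint T) :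
    ((ρ.expect T).re : ℂ) = ρ.expect T := by
  have h := ρ.expect_star T
  rw [hT.star_eq] at h
  exact Complex.conj_eq_iff_re.1 h.symm

lemma expect_star_mul_self_nonneg (T : H →L[ℂ] H) : 0 ≤ ρ.expect (star T * T) := by
  refine tsum_nonneg fun k => ?_
  rw [mul_apply_eq_comp, ContinuousLinearMap.star_eq_adjoint,
    ContinuousLinearMap.adjoint_inner_right, inner_self_eq_norm_sq_to_K,
    ← RCLike.ofReal_pow]
  exact RCLike.ofReal_nonneg.2 (sq_nonneg _)

lemma posSemidef_expect {ι : Type*} [Fintype ι] (g : ι → H →L[ℂ] H) :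
    (Matrix.of fun u v => ρ.expect (star (g u) * g v)).PosSemidef := by
  refine Matrix.PosSemidef.of_dotProduct_mulVec_nonneg ?_ fun x => ?_
  · ext u v
    simp [← expect_star]
  · convert ρ.expect_star_mul_self_nonneg (∑ v, x v • g v) using 1
    simp only [dotProduct, Matrix.mulVec, star_sum, Finset.sum_mul, Finset.mul_sum, expect_sum,
      star_smul, smul_mul_assoc, mul_smul_comm, expect_smul, Matrix.of_apply, Pi.star_apply]
    rw [Finset.sum_comm]
    refine Finset.sum_congr rfl fun v _ => Finset.sum_congr rfl fun u _ => ?_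
    ring

end DensityOp

/-! ### Moment matrices of measurements that need not be projective -/

section Effect

variable {H : Type*} [NormedAddCommGroup H] [InnerProductSpace ℂ H]

lemma IsEffect.nonneg {E : H →L[ℂ] H} (hE : IsEffect E) : 0 ≤ E :=
  (ContinuousLinearMap.nonneg_iff_isPositive E).2 hE.1

lemma IsEffect.one_sub_nonneg {E : H →L[ℂ] H} (hE : IsEffect E) : 0 ≤ 1 - E :=
  (ContinuousLinearMap.nonneg_iff_isPositive _).2 hE.2

variable [CompleteSpace H]

lemma IsEffect.isSelfAdjoint {E : H →L[ℂ] H} (hE : IsEffect E) : IsSelfAdjoint E :=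
  hE.nonneg.isSelfAdjoint

/-- The defect `√(E - E²)` of an effect from being a projection. -/
def effectDefect (E : H →L[ℂ] H) : H →L[ℂ] H := CFC.sqrt (E - E * E)

lemma effectDefect_isSelfAdjoint (E : H →L[ℂ] H) : IsSelfAdjoint (effectDefect E) :=
  (CFC.sqrt_nonneg (E - E * E)).isSelfAdjoint

lemma IsEffect.mul_self_add_effectDefect {E : H →L[ℂ] H} (hE : IsEffect E) :
    E * E + effectDefect E * effectDefect E = E := by
  have h : 0 ≤ E - E * E := by
    have := Commute.mul_nonneg hE.nonneg hE.one_sub_nonneg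
      ((Commute.one_right E).sub_right (Commute.refl E))
    rwa [mul_sub, mul_one] at this
  rw [effectDefect, CFC.sqrt_mul_sqrt_self _ h, add_sub_cancel]

lemma effectDefect_commute {E F : H →L[ℂ] H} (h : Commute E F) :
    Commute (effectDefect E) F :=
  Commute.cfcₙ_nnreal (h.sub_left (h.mul_left h)) _

/-- The factors of the moment operators of one party. The operator of the reduced word of `u† v` has
`E x` in place of `E x * E x` on the diagonal; the difference is the square of the defect of `E x`,
so that this operator is `∑ l, momentFactor E l u * momentFactor E l v`: the term `l = none` is the
actual product, and the term `l = some x` corrects the diagonal entry of `x`. -/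
def momentFactor (E : Fin 18 → H →L[ℂ] H) : Option (Fin 18) → Option (Fin 18) → H →L[ℂ] H
  | none, s => s.elim 1 E
  | some x, s => if s = some x then effectDefect (E x) else 0

lemma momentFactor_isSelfAdjoint {E : Fin 18 → H →L[ℂ] H} (hE : ∀ x, IsEffect (E x))
    (l s : Option (Fin 18)) : IsSelfAdjoint (momentFactor E l s) := by
  rcases l with _ | x
  · rcases s with _ | y
    · exact IsSelfAdjoint.one _
    · exact (hE y).isSelfAdjoint
  · rw [momentFactor]
    split_ifs
    · exact effectDefect_isSelfAdjoint _
    · exact IsSelfAdjoint.zero _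

lemma momentFactor_commute {E : Fin 18 → H →L[ℂ] H} {F : H →L[ℂ] H}
    (h : ∀ x, Commute (E x) F) (l s : Option (Fin 18)) : Commute (momentFactor E l s) F := by
  rcases l with _ | x
  · rcases s with _ | y
    · exact Commute.one_left _
    · exact h y
  · rw [momentFactor]
    split_ifs
    · exact effectDefect_commute (h x)
    · exact Commute.zero_left _

lemma prod_redWord {E : Fin 18 → H →L[ℂ] H} (hE : ∀ x, IsEffect (E x)) (s t : Option (Fin 18)) :
    ((redWord s t).map E).prod = ∑ l, momentFactor E l s * momentFactor E l t := by
  rw [Fintype.sum_option]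
  rcases s with _ | x <;> rcases t with _ | y
  · simp [redWord, momentFactor]
  · simp [redWord, momentFactor]
  · simp [redWord, momentFactor]
  · by_cases hxy : x = y
    · subst hxy
      simp [redWord, momentFactor, (hE x).mul_self_add_effectDefect]
    · have : ∀ z, (if x = z then effectDefect (E z) else 0) *
          (if y = z then effectDefect (E z) else 0) = 0 := fun z => by
        by_cases h : x = z
        · rw [if_neg (fun h' : y = z => hxy (h.trans h'.symm)), mul_zero]
        · rw [if_neg h, zero_mul]
      simp [redWord, momentFactor, hxy, this]

end Effect

/-- Expectations of words in the effects form a moment matrix even if the effects are not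
projections: it is a sum of Gram matrices, one for each pair of moment factors of the parties. -/
theorem commutingQuantumSet_subset_npaSet : commutingQuantumSet.{u} ⊆ npaSet := by
  rintro p ⟨H, _, _, _, S, rfl⟩
  refine ⟨fun w => S.state.expect ((w.1.map S.alice).prod * (w.2.map S.bob).prod), ?_, ?_, ?_,
    ?_, ?_⟩
  · have h : (Matrix.of fun u v : NPAIndex => S.state.expect
        (((redWord u.1 v.1).map S.alice).prod * ((redWord u.2 v.2).map S.bob).prod)) =
        ∑ l, ∑ l', Matrix.of fun u v : NPAIndex => S.state.expect
          (star (momentFactor S.alice l u.1 * momentFactor S.bob l' u.2) *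
            (momentFactor S.alice l v.1 * momentFactor S.bob l' v.2)) := by
      ext u v
      simp only [Matrix.sum_apply, Matrix.of_apply, prod_redWord S.alice_effect,
        prod_redWord S.bob_effect, Finset.sum_mul_sum, DensityOp.expect_sum]
      refine Finset.sum_congr rfl fun l _ => Finset.sum_congr rfl fun l' _ => ?_
      have hc : ∀ s t, Commute (momentFactor S.alice l s) (momentFactor S.bob l' t) := fun s t =>
        momentFactor_commute (fun x => (momentFactor_commute (fun y => (S.commute x y).symm) l'
          t).symm) l s
      rw [star_mul, (momentFactor_isSelfAdjoint S.alice_effect l u.1).star_eq,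
        (momentFactor_isSelfAdjoint S.bob_effect l' u.2).star_eq, ← (hc u.1 u.2).eq]
      congr 1
      simp only [mul_assoc]
      rw [← mul_assoc (momentFactor S.alice l v.1), (hc v.1 u.2).eq, mul_assoc]
    rw [h]
    exact Matrix.posSemidef_sum _ fun l _ => Matrix.posSemidef_sum _ fun l' _ =>
      S.state.posSemidef_expect _
  · simp [DensityOp.expect_one]
  · intro x
    simp [CommutingStrategy.behavior, S.state.ofReal_re_expect (S.alice_effect x).isSelfAdjoint]
  · intro y
    simp [CommutingStrategy.behavior, S.state.ofReal_re_expect (S.bob_effect y).isSelfAdjoint]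
  · intro x y
    have h : IsSelfAdjoint (S.alice x * S.bob y) :=
      ((S.alice_effect x).isSelfAdjoint.commute_iff (S.bob_effect y).isSelfAdjoint).1
        (S.commute x y)
    simp [CommutingStrategy.behavior, S.state.ofReal_re_expect h]

/-! ### Operators on Hilbert space tensor products -/

section OpTensor

variable {H K : Type*} [NormedAddCommGroup H] [InnerProductSpace ℂ H]
  [NormedAddCommGroup K] [InnerProductSpace ℂ K]

lemma opTensor_ext {S T : HilbertTensor H K →L[ℂ] HilbertTensor H K}
    (h : ∀ t : H ⊗[ℂ] K, S t = T t) : S = T := by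
  ext x
  induction x using UniformSpace.Completion.induction_on with
  | hp => exact isClosed_eq S.continuous T.continuous
  | ih t => exact h t

lemma opTensor_mul (E E' : H →L[ℂ] H) (F F' : K →L[ℂ] K) :
    opTensor E F * opTensor E' F' = opTensor (E * E') (F * F') := by
  refine opTensor_ext fun t => ?_
  simp only [opTensor, mul_apply_eq_comp, ContinuousLinearMap.completion_apply_coe,
    TensorProduct.mapL_mul]

lemma opTensor_one : opTensor (1 : H →L[ℂ] H) (1 : K →L[ℂ] K) = 1 := by
  refine opTensor_ext fun t => ?_
  simp only [opTensor, ContinuousLinearMap.completion_apply_coe]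
  rw [ContinuousLinearMap.one_def, ContinuousLinearMap.one_def, TensorProduct.mapL_id_id]
  rfl

lemma opTensor_sub_left (E E' : H →L[ℂ] H) (F : K →L[ℂ] K) :
    opTensor (E - E') F = opTensor E F - opTensor E' F := by
  refine opTensor_ext fun t => ?_
  simp only [opTensor, _root_.sub_apply, ContinuousLinearMap.completion_apply_coe,
    TensorProduct.mapL_apply, ← UniformSpace.Completion.coe_sub]
  congr 1
  rw [eq_sub_iff_add_eq, ← LinearMap.add_apply, ← TensorProduct.map_add_left]
  simp

lemma opTensor_sub_right (E : H →L[ℂ] H) (F F' : K →L[ℂ] K) :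
    opTensor E (F - F') = opTensor E F - opTensor E F' := by
  refine opTensor_ext fun t => ?_
  simp only [opTensor, _root_.sub_apply, ContinuousLinearMap.completion_apply_coe,
    TensorProduct.mapL_apply, ← UniformSpace.Completion.coe_sub]
  congr 1
  rw [eq_sub_iff_add_eq, ← LinearMap.add_apply, ← TensorProduct.map_add_right]
  simp

lemma inner_opTensor {E : H →L[ℂ] H} {F : K →L[ℂ] K} (hE : (E : H →ₗ[ℂ] H).IsSymmetric)
    (hF : (F : K →ₗ[ℂ] K).IsSymmetric) (x y : HilbertTensor H K) :
    inner ℂ (opTensor E F x) y = inner ℂ x (opTensor E F y) := by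
  induction x, y using UniformSpace.Completion.induction_on₂ with
  | hp => exact isClosed_eq (by fun_prop) (by fun_prop)
  | ih s t =>
    simp only [opTensor, ContinuousLinearMap.completion_apply_coe,
      UniformSpace.Completion.inner_coe, TensorProduct.mapL_apply]
    induction s using TensorProduct.induction_on with
    | zero => simp
    | add s s' hs hs' => simp [inner_add_left, hs, hs']
    | tmul a b =>
      induction t using TensorProduct.induction_on with
      | zero => simp
      | add t t' ht ht' => simp only [map_add, inner_add_right, ht, ht']
      | tmul c d =>
        have h1 := hE a c
        have h2 := hF b d
        simp only [ContinuousLinearMap.coe_coe] at h1 h2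
        simp [h1, h2]

variable [CompleteSpace H] [CompleteSpace K]

lemma isPositive_opTensor {E : H →L[ℂ] H} {F : K →L[ℂ] K} (hE : E.IsPositive)
    (hF : F.IsPositive) : (opTensor E F).IsPositive := by
  rw [← ContinuousLinearMap.nonneg_iff_isPositive] at hE hF
  have hE' := (ContinuousLinearMap.nonneg_iff_isPositive _).1 (CFC.sqrt_nonneg E)
  have hF' := (ContinuousLinearMap.nonneg_iff_isPositive _).1 (CFC.sqrt_nonneg F)
  have h := inner_opTensor hE'.isSymmetric hF'.isSymmetric
  have h2 : opTensor E F =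
      opTensor (CFC.sqrt E) (CFC.sqrt F) * opTensor (CFC.sqrt E) (CFC.sqrt F) := by
    rw [opTensor_mul, CFC.sqrt_mul_sqrt_self E hE, CFC.sqrt_mul_sqrt_self F hF]
  rw [h2, ContinuousLinearMap.isPositive_def]
  refine ⟨fun x y => ?_, fun x => ?_⟩
  · simp [h]
  · rw [ContinuousLinearMap.reApplyInnerSelf_apply, mul_apply_eq_comp, h]
    exact inner_self_nonneg

lemma isEffect_opTensor_one {E : H →L[ℂ] H} (hE : IsEffect E) :
    IsEffect (opTensor E (1 : K →L[ℂ] K)) := by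
  refine ⟨isPositive_opTensor hE.1 ContinuousLinearMap.isPositive_one, ?_⟩
  rw [← opTensor_one, ← opTensor_sub_left]
  exact isPositive_opTensor hE.2 ContinuousLinearMap.isPositive_one

lemma isEffect_one_opTensor {F : K →L[ℂ] K} (hF : IsEffect F) :
    IsEffect (opTensor (1 : H →L[ℂ] H) F) := by
  refine ⟨isPositive_opTensor ContinuousLinearMap.isPositive_one hF.1, ?_⟩
  rw [← opTensor_one, ← opTensor_sub_right]
  exact isPositive_opTensor ContinuousLinearMap.isPositive_one hF.2

end OpTensor

theorem tensorQuantumSet_subset_commutingQuantumSet :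
    tensorQuantumSet.{u} ⊆ commutingQuantumSet.{u} := by
  rintro p ⟨H, K, _, _, _, _, _, _, S, rfl⟩
  refine ⟨HilbertTensor H K, inferInstance, inferInstance, inferInstance,
    { state := S.state
      alice := fun x => opTensor (S.alice x) 1
      bob := fun y => opTensor 1 (S.bob y)
      alice_effect := fun x => isEffect_opTensor_one (S.alice_effect x)
      bob_effect := fun y => isEffect_one_opTensor (S.bob_effect y)
      commute := fun x y => ?_ }, ?_⟩
  · rw [Commute, SemiconjBy, opTensor_mul, opTensor_mul]
    simp
  · simp [CommutingStrategy.behavior, TensorStrategy.behavior, opTensor_mul]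

theorem finiteQuantumSet_subset_tensorQuantumSet :
    finiteQuantumSet.{u} ⊆ tensorQuantumSet.{u} := by
  rintro p ⟨H, K, _, _, _, _, _, _, S, rfl⟩
  exact ⟨H, K, inferInstance, inferInstance, inferInstance, inferInstance,
    FiniteDimensional.complete ℂ H, FiniteDimensional.complete ℂ K, S, rfl⟩

/-! ### The maximally entangled strategy -/

lemma star_maxEnt_dotProduct_kronecker (P Q : Matrix (Fin 4) (Fin 4) ℂ) :
    star maxEnt ⬝ᵥ (P ⊗ₖ Q).mulVec maxEnt = 1 / 4 * ∑ i, ∑ j, P i j * Q i j := by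
  have h : ∀ s, (P ⊗ₖ Q).mulVec maxEnt s = 1 / 2 * ∑ j, P s.1 j * Q s.2 j := fun s => by
    simp only [Matrix.mulVec, dotProduct, Fintype.sum_prod_type, maxEnt, mul_ite, mul_zero,
      Finset.sum_ite_eq, Finset.mem_univ, if_true, Finset.mul_sum]
    exact Finset.sum_congr rfl fun j _ => by rw [Matrix.kroneckerMap_apply]; ring
  simp only [dotProduct, h, Fintype.sum_prod_type, Pi.star_apply, maxEnt, apply_ite star, star_zero,
    ite_mul, zero_mul, Finset.sum_ite_eq, Finset.mem_univ, if_true]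
  rw [Finset.mul_sum]
  refine Finset.sum_congr rfl fun i _ => ?_
  simp
  ring

/-- The squared length of the `i`-th vector. -/
def ksNormSq (i : Fin 18) : ℤ := ∑ r, ksVec i r ^ 2

/-- The inner product of two of the vectors. -/
def ksDot (x y : Fin 18) : ℤ := ∑ r, ksVec x r * ksVec y r

lemma ksNormSq_pos (i : Fin 18) : 0 < ksNormSq i := by
  revert i
  decide +kernel

lemma ksNormSq_ne_zero (i : Fin 18) : (ksNormSq i : ℂ) ≠ 0 := by
  exact_mod_cast (ksNormSq_pos i).ne'

lemma ksProj_apply (i : Fin 18) (s t : Fin 4) :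
    ksProj i s t = (ksVec i s * ksVec i t) / ksNormSq i := by
  simp [ksProj, ksNormSq]

lemma ksProj_isHermitian (i : Fin 18) : (ksProj i).IsHermitian := by
  ext s t
  simp [ksProj_apply, mul_comm]

lemma ksProj_mul_self (i : Fin 18) : ksProj i * ksProj i = ksProj i := by
  ext s t
  have h := ksNormSq_ne_zero i
  have h2 : ∑ r, (ksVec i r : ℂ) ^ 2 = ksNormSq i := by simp [ksNormSq]
  simp only [Matrix.mul_apply, ksProj_apply]
  calc ∑ r, (ksVec i s * ksVec i r : ℂ) / ksNormSq i * ((ksVec i r * ksVec i t) / ksNormSq i)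
      = (ksVec i s * ksVec i t) / ksNormSq i ^ 2 * ∑ r, (ksVec i r : ℂ) ^ 2 := by
        rw [Finset.mul_sum]
        exact Finset.sum_congr rfl fun r _ => by ring
    _ = _ := by rw [h2]; field_simp

lemma ksProj_posSemidef (i : Fin 18) : (ksProj i).PosSemidef := by
  have h := Matrix.posSemidef_conjTranspose_mul_self (ksProj i)
  rwa [(ksProj_isHermitian i).eq, ksProj_mul_self] at h

lemma one_sub_ksProj_posSemidef (i : Fin 18) : (1 - ksProj i).PosSemidef := by
  have h := Matrix.posSemidef_conjTranspose_mul_self (1 - ksProj i)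
  rwa [Matrix.conjTranspose_sub, Matrix.conjTranspose_one, (ksProj_isHermitian i).eq, mul_sub,
    sub_mul, sub_mul, ksProj_mul_self, one_mul, mul_one, one_mul, sub_self, sub_zero] at h

section MaxEntStrategy

variable {H : Type*} [NormedAddCommGroup H] [InnerProductSpace ℂ H]
  (b : OrthonormalBasis (Fin 4) ℂ H)

/-- The operator with matrix `P` in an orthonormal basis. -/
def matrixOp (P : Matrix (Fin 4) (Fin 4) ℂ) : H →L[ℂ] H :=
  haveI := b.toBasis.finiteDimensional_of_finite
  (Matrix.toLin b.toBasis b.toBasis P).toContinuousLinearMap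

lemma matrixOp_one : matrixOp b 1 = 1 := by
  ext x
  simp [matrixOp]

lemma matrixOp_sub (P Q : Matrix (Fin 4) (Fin 4) ℂ) :
    matrixOp b (P - Q) = matrixOp b P - matrixOp b Q := by
  ext x
  simp [matrixOp]

lemma inner_matrixOp (P : Matrix (Fin 4) (Fin 4) ℂ) (i j : Fin 4) :
    inner ℂ (b i) (matrixOp b P (b j)) = P i j := by
  have h := Matrix.toLin_self b.toBasis b.toBasis P j
  simp only [OrthonormalBasis.coe_toBasis] at h
  simp [matrixOp, h, b.inner_eq_ite]

lemma isPositive_matrixOp {P : Matrix (Fin 4) (Fin 4) ℂ} (hP : P.PosSemidef) :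
    (matrixOp b P).IsPositive := by
  have := b.toBasis.finiteDimensional_of_finite
  rw [matrixOp, LinearMap.isPositive_toContinuousLinearMap_iff,
    ← LinearMap.posSemidef_toMatrix_iff b, LinearMap.toMatrix_toLin]
  exact hP

lemma isEffect_matrixOp_ksProj (i : Fin 18) : IsEffect (matrixOp b (ksProj i)) := by
  refine ⟨isPositive_matrixOp b (ksProj_posSemidef i), ?_⟩
  rw [← matrixOp_one b, ← matrixOp_sub]
  exact isPositive_matrixOp b (one_sub_ksProj_posSemidef i)

/-- The maximally entangled vector `1/2 ∑ j, b j ⊗ b j`. -/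
def maxEntVec : HilbertTensor H H := (((1 / 2 : ℂ) • ∑ j, b j ⊗ₜ[ℂ] b j : H ⊗[ℂ] H) :)

lemma inner_maxEntVec (P Q : Matrix (Fin 4) (Fin 4) ℂ) :
    inner ℂ (maxEntVec b) (opTensor (matrixOp b P) (matrixOp b Q) (maxEntVec b)) =
      1 / 4 * ∑ i, ∑ j, P i j * Q i j := by
  have h : TensorProduct.mapL (matrixOp b P) (matrixOp b Q) ((1 / 2 : ℂ) • ∑ j, b j ⊗ₜ[ℂ] b j) =
      (1 / 2 : ℂ) • ∑ j, matrixOp b P (b j) ⊗ₜ[ℂ] matrixOp b Q (b j) := by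
    simp only [map_smul, map_sum, TensorProduct.mapL_tmul]
  rw [maxEntVec, opTensor, ContinuousLinearMap.completion_apply_coe,
    UniformSpace.Completion.inner_coe, h]
  have h2 : ∀ s t : H ⊗[ℂ] H, inner ℂ ((1 / 2 : ℂ) • s) ((1 / 2 : ℂ) • t) = 1 / 4 * inner ℂ s t := by
    intro s t
    rw [inner_smul_left (𝕜 := ℂ) s _ (1 / 2), inner_smul_right (𝕜 := ℂ) s t (1 / 2),
      map_div₀, map_one, map_ofNat]
    ring
  rw [h2, sum_inner]
  simp only [inner_sum, TensorProduct.inner_tmul, inner_matrixOp]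

lemma norm_maxEntVec_sq : ‖maxEntVec b‖ ^ 2 = 1 := by
  have h := inner_maxEntVec b 1 1
  rw [matrixOp_one, opTensor_one, one_apply_eq_self, inner_self_eq_norm_sq_to_K] at h
  have h2 : (1 / 4 : ℂ) * ∑ i : Fin 4, ∑ j : Fin 4,
      (1 : Matrix (Fin 4) (Fin 4) ℂ) i j * (1 : Matrix (Fin 4) (Fin 4) ℂ) i j = 1 := by
    simp [Matrix.one_apply]
  rw [h2, ← RCLike.ofReal_pow] at h
  exact RCLike.ofReal_injective (K := ℂ) (by rw [h, RCLike.ofReal_one])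

/-- The pure maximally entangled state. -/
def maxEntState : DensityOp (HilbertTensor H H) where
  vec k := if k = 0 then maxEntVec b else 0
  trace_one := by
    convert hasSum_ite_eq 0 (1 : ℝ) using 2 with k
    split_ifs <;> simp [norm_maxEntVec_sq]

lemma maxEntState_expect (T : HilbertTensor H H →L[ℂ] HilbertTensor H H) :
    (maxEntState b).expect T = inner ℂ (maxEntVec b) (T (maxEntVec b)) := by
  rw [DensityOp.expect, tsum_eq_single 0]
  · simp [maxEntState]
  · intro k hk
    simp [maxEntState, hk]

/-- Both parties measure the Kochen-Specker projectors on the maximally entangled state. -/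
def ksStrategy : TensorStrategy H H where
  state := maxEntState b
  alice x := matrixOp b (ksProj x)
  bob y := matrixOp b (ksProj y)
  alice_effect := isEffect_matrixOp_ksProj b
  bob_effect := isEffect_matrixOp_ksProj b

lemma ksStrategy_behavior : (ksStrategy b).behavior = ksBehavior := by
  simp only [TensorStrategy.behavior, ksStrategy, ksBehavior, maxEntExpect, ← matrixOp_one b,
    maxEntState_expect, inner_maxEntVec, star_maxEnt_dotProduct_kronecker]

end MaxEntStrategy

theorem ksBehavior_mem_finiteQuantumSet : ksBehavior ∈ finiteQuantumSet.{u} := by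
  let b : OrthonormalBasis (Fin 4) ℂ (EuclideanSpace ℂ (ULift.{u} (Fin 4))) :=
    (EuclideanSpace.basisFun (ULift.{u} (Fin 4)) ℂ).reindex Equiv.ulift
  exact ⟨_, _, inferInstance, inferInstance, inferInstance, inferInstance, inferInstance,
    inferInstance, ksStrategy b, ksStrategy_behavior b⟩

/-! ### Values of the KS18 correlations -/

lemma ksBehavior_joint (x y : Fin 18) :
    ksBehavior.2.2 x y = (ksDot x y : ℝ) ^ 2 / (4 * ksNormSq x * ksNormSq y) := by
  have h : star maxEnt ⬝ᵥ (ksProj x ⊗ₖ ksProj y).mulVec maxEnt =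
      (((ksDot x y : ℝ) ^ 2 / (4 * ksNormSq x * ksNormSq y) : ℝ) : ℂ) := by
    rw [star_maxEnt_dotProduct_kronecker]
    simp only [ksProj_apply, ksDot]
    push_cast
    rw [sq, Finset.sum_mul_sum, Finset.mul_sum, Finset.sum_div]
    refine Finset.sum_congr rfl fun i _ => ?_
    rw [Finset.mul_sum, Finset.sum_div]
    refine Finset.sum_congr rfl fun j _ => ?_
    have h1 := ksNormSq_ne_zero x
    have h2 := ksNormSq_ne_zero y
    field_simp
  simp only [ksBehavior, maxEntExpect, h, Complex.ofReal_re]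

lemma sum_ksProj_diag (x : Fin 18) : ∑ i, ksProj x i i = 1 := by
  simp only [ksProj_apply]
  rw [← Finset.sum_div, div_eq_one_iff_eq (ksNormSq_ne_zero x)]
  simp [ksNormSq, sq]

lemma ksBehavior_alice (x : Fin 18) : ksBehavior.1 x = 1 / 4 := by
  simp only [ksBehavior, maxEntExpect, star_maxEnt_dotProduct_kronecker]
  simp [Matrix.one_apply, sum_ksProj_diag]

lemma ksBehavior_bob (y : Fin 18) : ksBehavior.2.1 y = 1 / 4 := by
  simp only [ksBehavior, maxEntExpect, star_maxEnt_dotProduct_kronecker]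
  simp [Matrix.one_apply, sum_ksProj_diag]

theorem bellT_ksBehavior : bellT ksBehavior = 45 / 4 := by
  -- the squared lengths are 1, 2 and 4, so the integer division `4 / ksNormSq x` is exact
  have h1 : ∀ x, ksNormSq x * (4 / ksNormSq x) = 4 := by decide +kernel
  have h2 : ∑ x, ∑ y, coeffPattern (-2) (-2) 1 0 (-2) 0 y x *
      (ksDot x y ^ 2 * (4 / ksNormSq x) * (4 / ksNormSq y)) = 720 := by decide +kernel
  have h3 : ∀ x y, ksBehavior.2.2 x y =
      ((ksDot x y ^ 2 * (4 / ksNormSq x) * (4 / ksNormSq y) : ℤ) : ℝ) / 64 := fun x y => by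
    have hx : (ksNormSq x : ℝ) * ((4 / ksNormSq x : ℤ) : ℝ) = 4 := by exact_mod_cast h1 x
    have hy : (ksNormSq y : ℝ) * ((4 / ksNormSq y : ℤ) : ℝ) = 4 := by exact_mod_cast h1 y
    have hx0 : (ksNormSq x : ℝ) ≠ 0 := by exact_mod_cast (ksNormSq_pos x).ne'
    have hy0 : (ksNormSq y : ℝ) ≠ 0 := by exact_mod_cast (ksNormSq_pos y).ne'
    rw [ksBehavior_joint, Int.cast_mul, Int.cast_mul, eq_div_of_mul_eq hx0 ((mul_comm _ _).trans hx),
      eq_div_of_mul_eq hy0 ((mul_comm _ _).trans hy)]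
    push_cast
    field_simp
    norm_num
  simp only [bellT, bellValue, Pi.zero_apply, zero_mul, Finset.sum_const_zero, add_zero, h3,
    Matrix.map_apply, ← mul_div_assoc, ← Finset.sum_div]
  have h4 := congrArg (Int.cast : ℤ → ℝ) h2
  push_cast at h4 ⊢
  rw [h4]
  norm_num

/-! ### The grid and the magic square -/

/-- Entry `j` of row `i` is the vector attached to row `i` of the grid and to its point `(i, j)`. -/
def rowVec : Fin 3 → Fin 3 → Fin 18 := ![![0, 1, 2], ![5, 3, 4], ![6, 8, 7]]

/-- Entry `i` of column `j` is the vector attached to column `j` of the grid and to its point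
`(i, j)`. -/
def colVec : Fin 3 → Fin 3 → Fin 18 := ![![11, 13, 17], ![9, 14, 15], ![10, 12, 16]]

/-- The orthogonal basis attached to the point `(i, j)` of the grid. -/
def ksBasis (i j : Fin 3) : Finset (Fin 18) :=
  (Finset.univ.erase j).image (rowVec i) ∪ (Finset.univ.erase i).image fun k => colVec k j

lemma exists_rowVec_or_colVec (x : Fin 18) :
    (∃ i j, x = rowVec i j) ∨ ∃ i j, x = colVec i j := by
  revert x
  decide +kernel

lemma ksDot_rowVec {i j j' : Fin 3} (h : j ≠ j') : ksDot (rowVec i j) (rowVec i j') = 0 := by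
  revert i j j'
  decide +kernel

lemma ksDot_colVec {i i' j : Fin 3} (h : i ≠ i') : ksDot (colVec i j) (colVec i' j) = 0 := by
  revert i i' j
  decide +kernel

lemma card_ksBasis (i j : Fin 3) : (ksBasis i j).card = 4 := by
  revert i j
  decide +kernel

lemma ksDot_of_mem_ksBasis {i j : Fin 3} {x y : Fin 18} (hx : x ∈ ksBasis i j)
    (hy : y ∈ ksBasis i j) (hxy : x ≠ y) : ksDot x y = 0 := by
  have h : ∀ i j, ∀ x ∈ ksBasis i j, ∀ y ∈ ksBasis i j, x ≠ y → ksDot x y = 0 := by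
    decide +kernel
  exact h i j x hx y hy hxy

lemma sum_ksBasis {M : Type*} [AddCommGroup M] (f : Fin 18 → M) (i j : Fin 3) :
    ∑ x ∈ ksBasis i j, f x =
      (∑ k, f (rowVec i k) - f (rowVec i j)) + (∑ k, f (colVec k j) - f (colVec i j)) := by
  have h1 : ∀ i j, Disjoint ((Finset.univ.erase j).image (rowVec i))
    ((Finset.univ.erase i).image fun k => colVec k j) := by decide +kernel
  have h2 : ∀ i, Function.Injective (rowVec i) := by decide +kernel
  have h3 : ∀ j, Function.Injective fun k => colVec k j := by decide +kernel
  rw [ksBasis, Finset.sum_union (h1 i j), Finset.sum_image (h2 i).injOn,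
    Finset.sum_image (h3 j).injOn, Finset.sum_erase_eq_sub (Finset.mem_univ j),
    Finset.sum_erase_eq_sub (Finset.mem_univ i)]

section MagicSquare

variable {A : Type*} [Ring A]

/-- The observables with values `±1` of a measurement with three listed outcomes `p` and one more,
unlisted outcome: the `j`-th takes the value `-1` at the outcome `j` and at the unlisted one. -/
def lineObs (p : Fin 3 → A) (j : Fin 3) : A := 2 * (∑ k, p k - p j) - 1

lemma fin_three_sum {M : Type*} [AddCommMonoid M] (p : Fin 3 → M) {j j' : Fin 3} (h : j ≠ j') :
    ∑ k, p k = p j + p j' + p (-(j + j')) := by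
  have hu : ∀ j j' : Fin 3, j ≠ j' →
      (Finset.univ : Finset (Fin 3)) = {j, j', -(j + j')} ∧ j ≠ -(j + j') ∧ j' ≠ -(j + j') := by
    decide
  obtain ⟨h1, h2, h3⟩ := hu j j' h
  rw [h1, Finset.sum_insert (by simpa only [Finset.mem_insert,
    Finset.mem_singleton, not_or] using ⟨h, h2⟩), Finset.sum_pair h3, add_assoc]

section Line

variable {p : Fin 3 → A} (idem : ∀ j, p j * p j = p j) (orth : ∀ j j', j ≠ j' → p j * p j' = 0)
include idem orth

lemma sum_mul_of_orthogonal (j : Fin 3) : (∑ k, p k) * p j = p j := by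
  rw [Finset.sum_mul, Finset.sum_eq_single j (fun k _ hk => orth k j hk) (by simp), idem]

lemma mul_sum_of_orthogonal (j : Fin 3) : p j * (∑ k, p k) = p j := by
  rw [Finset.mul_sum, Finset.sum_eq_single j (fun k _ hk => orth j k hk.symm) (by simp), idem]

lemma sum_mul_sum_of_orthogonal : (∑ k, p k) * (∑ k, p k) = ∑ k, p k := by
  rw [Finset.mul_sum]
  exact Finset.sum_congr rfl fun j _ => sum_mul_of_orthogonal idem orth j

lemma lineObs_mul_self (j : Fin 3) : lineObs p j * lineObs p j = 1 := by
  have h1 := sum_mul_of_orthogonal idem orth j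
  have h2 := mul_sum_of_orthogonal idem orth j
  have h3 := sum_mul_sum_of_orthogonal idem orth
  have h4 : lineObs p j * lineObs p j = 4 * ((∑ k, p k) * (∑ k, p k) - (∑ k, p k) * p j
      - p j * (∑ k, p k) + p j * p j - ∑ k, p k + p j) + 1 := by
    rw [lineObs]
    noncomm_ring
  rw [h4, h1, h2, h3, idem]
  noncomm_ring

/-- The product of the three observables of a line is `-1`. -/
lemma lineObs_mul {j j' : Fin 3} (h : j ≠ j') :
    lineObs p j * lineObs p j' = -lineObs p (-(j + j')) := by
  have h1 := sum_mul_of_orthogonal idem orth j'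
  have h2 := mul_sum_of_orthogonal idem orth j
  have h3 := sum_mul_sum_of_orthogonal idem orth
  have h4 : lineObs p j * lineObs p j' = 4 * ((∑ k, p k) * (∑ k, p k) - (∑ k, p k) * p j'
      - p j * (∑ k, p k) + p j * p j' - ∑ k, p k) + 2 * p j + 2 * p j' + 1 := by
    rw [lineObs, lineObs]
    noncomm_ring
  rw [h4, h1, h2, h3, orth j j' h, lineObs, fin_three_sum p h]
  noncomm_ring

end Line

lemma one_add_sum_lineObs (p : Fin 3 → A) (j : Fin 3) :
    1 + (∑ l, lineObs p l - 2 * lineObs p j) = 4 * p j := by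
  have h : ∑ l, lineObs p l = 4 * ∑ k, p k - (1 + 1 + 1) := by
    simp only [lineObs, Fin.sum_univ_three]
    noncomm_ring
  rw [h, lineObs]
  noncomm_ring

/-- In a Mermin-Peres magic square (products `-1` along rows and `1` along columns), entries which
are not in a common row or column anticommute. -/
lemma magicSquare_anticommute {O : Fin 3 → Fin 3 → A} (sq : ∀ i j, O i j * O i j = 1)
    (row : ∀ i j j', j ≠ j' → O i j * O i j' = -O i (-(j + j')))
    (col : ∀ i i' j, i ≠ i' → O i j * O i' j = O (-(i + i')) j)
    {i i' j j' : Fin 3} (hi : i ≠ i') (hj : j ≠ j') :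
    O i j * O i' j' = -(O i' j' * O i j) := by
  -- the entry at the intersection of the two remaining lines, computed along its column and row
  have h1 : O (-(i + i')) (-(j + j')) = (O i j' * O i j) * (O i' j' * O i' j) := by
    rw [row i j' j hj.symm, row i' j' j hj.symm, neg_mul_neg, col i i' _ hi, add_comm j' j]
  have h2 : O (-(i + i')) (-(j + j')) = -((O i j' * O i' j') * (O i j * O i' j)) := by
    rw [col i i' j' hi, col i i' j hi, row _ j' j hj.symm, neg_neg, add_comm j' j]
  have h3 : O i j' * ((O i j' * O i j) * (O i' j' * O i' j)) * O i' j =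
      O i j' * -((O i j' * O i' j') * (O i j * O i' j)) * O i' j := by rw [← h1, h2]
  calc O i j * O i' j'
      = (O i j' * O i j') * O i j * O i' j' * (O i' j * O i' j) := by rw [sq, sq, one_mul, mul_one]
    _ = O i j' * ((O i j' * O i j) * (O i' j' * O i' j)) * O i' j := by simp only [mul_assoc]
    _ = -((O i j' * O i j') * O i' j' * O i j * (O i' j * O i' j)) := by
        rw [h3]
        simp only [mul_assoc, mul_neg, neg_mul]
    _ = -(O i' j' * O i j) := by rw [sq, sq, one_mul, mul_one]

/-- A trace vanishes on the entries of a magic square, which are orthonormal for it. -/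
lemma magicSquare_trace [Algebra ℂ A] {O : Fin 3 → Fin 3 → A} (sq : ∀ i j, O i j * O i j = 1)
    (row : ∀ i j j', j ≠ j' → O i j * O i j' = -O i (-(j + j')))
    (col : ∀ i i' j, i ≠ i' → O i j * O i' j = O (-(i + i')) j)
    (τ : A →ₗ[ℂ] ℂ) (tr : ∀ i j a, τ (O i j * a) = τ (a * O i j)) :
    (∀ i j, τ (O i j) = 0) ∧
      ∀ i j i' j', τ (O i j * O i' j') = if i = i' ∧ j = j' then τ 1 else 0 := by
  have h0 : ∀ i j, τ (O i j) = 0 := fun i j => by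
    have hac := magicSquare_anticommute sq row col (i := i) (i' := i + 1) (j := j) (j' := j + 1)
      (by simp) (by simp)
    have h1 : τ (O i j) = τ (O (i + 1) (j + 1) * (O i j * O (i + 1) (j + 1))) := by
      rw [tr, mul_assoc, sq, mul_one]
    have h2 : O (i + 1) (j + 1) * (O i j * O (i + 1) (j + 1)) = -O i j := by
      rw [hac, mul_neg, ← mul_assoc, sq, one_mul]
    rw [h2, map_neg] at h1
    exact self_eq_neg.1 h1
  refine ⟨h0, fun i j i' j' => ?_⟩
  by_cases hi : i = i'
  · subst hi
    by_cases hj : j = j'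
    · subst hj
      simp [sq]
    · rw [row i j j' hj, map_neg, h0, neg_zero, if_neg (fun h => hj h.2)]
  · rw [if_neg (fun h => hi h.1)]
    by_cases hj : j = j'
    · subst hj
      rw [col i i' j hi, h0]
    · have h1 := tr i j (O i' j')
      rw [magicSquare_anticommute sq row col hi hj, map_neg] at h1
      rw [magicSquare_anticommute sq row col hi hj, map_neg, neg_eq_zero]
      exact self_eq_neg.1 h1.symm

end MagicSquare

/-- Four times the projector onto the line of the vector `x` is the sum of the identity and of the
entries `(i, j)` of the magic square with coefficients `ksSign x i j`. -/
def ksSign (x : Fin 18) (i j : Fin 3) : ℤ :=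
  if x = rowVec i j then -1 else if ∃ k, x = rowVec i k then 1 else
  if x = colVec i j then 1 else if ∃ k, x = colVec k j then -1 else 0

lemma ksSign_rowVec (i j k l : Fin 3) : ksSign (rowVec i j) k l =
    (if k = i then 1 else 0) * (1 - 2 * if l = j then 1 else 0) := by
  revert i j k l
  decide +kernel

lemma ksSign_colVec (i j k l : Fin 3) : ksSign (colVec i j) k l =
    (if l = j then 1 else 0) * (-1 + 2 * if k = i then 1 else 0) := by
  revert i j k l
  decide +kernel

lemma ksSign_sum (x y : Fin 18) :
    ksNormSq x * ksNormSq y * (1 + ∑ i, ∑ j, ksSign x i j * ksSign y i j) =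
      4 * ksDot x y ^ 2 := by
  revert x y
  decide +kernel

/-- The orthogonality relations of the 18 vectors determine the values of a trace on products of
at most two of the projectors. -/
theorem ks_trace {A : Type*} [Ring A] [Algebra ℂ A] (P : Fin 18 → A)
    (idem : ∀ x, P x * P x = P x) (orth : ∀ x y, ksDot x y = 0 → P x * P y = 0)
    (basis : ∀ i j, ∑ x ∈ ksBasis i j, P x = 1)
    (τ : A →ₗ[ℂ] ℂ) (tr : ∀ x a, τ (P x * a) = τ (a * P x)) :
    (∀ x, τ (P x) = 1 / 4 * τ 1) ∧
      ∀ x y, τ (P x * P y) = ksDot x y ^ 2 / (4 * ksNormSq x * ksNormSq y) * τ 1 := by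
  -- the square of row observables; by the basis relations the column observables are `-O`
  set O : Fin 3 → Fin 3 → A := fun i => lineObs fun j => P (rowVec i j) with hO
  have hcol : ∀ i j, O i j = -lineObs (fun k => P (colVec k j)) i := fun i j => by
    have h := basis i j
    rw [sum_ksBasis] at h
    simp only [hO, lineObs]
    rw [← h]
    noncomm_ring
  have sq : ∀ i j, O i j * O i j = 1 := fun i j =>
    lineObs_mul_self (fun _ => idem _) (fun _ _ h => orth _ _ (ksDot_rowVec h)) j
  have row : ∀ i j j', j ≠ j' → O i j * O i j' = -O i (-(j + j')) := fun i j j' h =>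
    lineObs_mul (fun _ => idem _) (fun _ _ h => orth _ _ (ksDot_rowVec h)) h
  have col : ∀ i i' j, i ≠ i' → O i j * O i' j = O (-(i + i')) j := fun i i' j h => by
    rw [hcol, hcol, hcol, neg_mul_neg]
    exact lineObs_mul (p := fun k => P (colVec k j)) (fun _ => idem _)
      (fun _ _ h => orth _ _ (ksDot_colVec h)) h
  have trO : ∀ i j a, τ (O i j * a) = τ (a * O i j) := fun i j a => by
    simp only [hO, lineObs, two_mul, sub_mul, mul_sub, add_mul, mul_add, Finset.sum_mul,
      Finset.mul_sum, map_sub, map_add, map_sum, tr, one_mul, mul_one]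
  obtain ⟨h1, h2⟩ := magicSquare_trace sq row col τ trO
  have hP : ∀ x, P x = (1 / 4 : ℂ) • (1 + ∑ i, ∑ j, (ksSign x i j : ℂ) • O i j) := fun x => by
    have h4 : ∀ a : A, (1 / 4 : ℂ) • (4 * a) = a := fun a => by
      rw [← map_ofNat (algebraMap ℂ A) 4, ← Algebra.smul_def, smul_smul]
      norm_num
    rcases exists_rowVec_or_colVec x with ⟨k, l, rfl⟩ | ⟨k, l, rfl⟩
    · have h3 : ∑ i, ∑ j, (ksSign (rowVec k l) i j : ℂ) • O i j = ∑ j, O k j - 2 * O k l := by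
        simp [ksSign_rowVec, mul_sub, sub_smul, two_mul, two_smul]
      rw [h3, one_add_sum_lineObs, h4]
    · have h3 : ∑ i, ∑ j, (ksSign (colVec k l) i j : ℂ) • O i j =
          ∑ i, -O i l - 2 * -O k l := by
        simp [ksSign_colVec, mul_add, add_smul, two_mul, two_smul, Finset.sum_add_distrib]
        abel
      rw [h3]
      simp only [hcol, neg_neg]
      rw [one_add_sum_lineObs, h4]
  constructor
  · intro x
    rw [hP x]
    simp [h1]
  · intro x y
    have h3 : τ (P x * P y) = 1 / 16 * (1 + ∑ i, ∑ j, (ksSign x i j * ksSign y i j : ℂ)) * τ 1 := by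
      rw [hP x, hP y]
      simp [add_mul, mul_add, Finset.sum_mul, Finset.mul_sum, h1, h2, ite_and]
      rw [← mul_assoc, show (4⁻¹ : ℂ) * 4⁻¹ = 16⁻¹ by norm_num]
      congr 1
      refine Finset.sum_congr rfl fun i _ => Finset.sum_congr rfl fun j _ => ?_
      ring
    rw [h3]
    have h4 : (ksNormSq x : ℂ) * ksNormSq y * (1 + ∑ i, ∑ j, (ksSign x i j * ksSign y i j : ℂ)) =
      4 * ksDot x y ^ 2 := by exact_mod_cast ksSign_sum x y
    have h5 := ksNormSq_ne_zero x
    have h6 := ksNormSq_ne_zero y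
    congr 1
    field_simp
    linear_combination 4 * h4

/-! ### Rigidity of perfect strategies and extremality -/

section Rigidity

variable {H : Type*} [NormedAddCommGroup H] [InnerProductSpace ℂ H]

/-- The subspace of the vectors `T v`, where `T` commutes with all the operators `E x`. -/
def commutantOrbit (E : Fin 18 → H →L[ℂ] H) (v : H) : Submodule ℂ H :=
  (Subalgebra.toSubmodule (Subalgebra.centralizer ℂ (Set.range E))).map
    (ContinuousLinearMap.apply ℂ H v : (H →L[ℂ] H) →ₗ[ℂ] H)

variable {E F : Fin 18 → H →L[ℂ] H} {v : H}

lemma mem_commutantOrbit {w : H} :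
    w ∈ commutantOrbit E v ↔ ∃ T : H →L[ℂ] H, (∀ x, Commute (E x) T) ∧ T v = w := by
  simp [commutantOrbit, Subalgebra.mem_centralizer_iff, Commute, SemiconjBy]

/-- A relation between the operators of one party that holds on `v` holds on the whole orbit. -/
lemma apply_eq_of_mem_commutantOrbit {w : H} (hw : w ∈ commutantOrbit E v) {R S : H →L[ℂ] H}
    (hR : ∀ T : H →L[ℂ] H, (∀ x, Commute (E x) T) → Commute R T)
    (hS : ∀ T : H →L[ℂ] H, (∀ x, Commute (E x) T) → Commute S T) (h : R v = S v) : R w = S w := by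
  obtain ⟨T, hT, rfl⟩ := mem_commutantOrbit.1 hw
  rw [← mul_apply_eq_comp, ← mul_apply_eq_comp, (hR T hT).eq, (hS T hT).eq, mul_apply_eq_comp,
    mul_apply_eq_comp, h]

variable [CompleteSpace H]

/-- If the operators `E` of one party satisfy the relations of the 18 projectors on `v`, and act on
`v` like commuting operators `F`, then the correlations in the state `v` are determined. -/
theorem ks_rigidity (hE : ∀ x, IsSelfAdjoint (E x)) (hF : ∀ x, IsSelfAdjoint (F x))
    (hEF : ∀ x y, Commute (E x) (F y)) (h1 : ∀ x, E x v = F x v)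
    (idem : ∀ x, E x (E x v) = E x v) (orth : ∀ x y, ksDot x y = 0 → E x (E y v) = 0)
    (basis : ∀ i j, ∑ x ∈ ksBasis i j, E x v = v) :
    (∀ x, inner ℂ v (E x v) = 1 / 4 * inner ℂ v v) ∧
      ∀ x y, inner ℂ v (E x (F y v)) =
        ksDot x y ^ 2 / (4 * ksNormSq x * ksNormSq y) * inner ℂ v v := by
  -- on `W` the relations hold as operator identities, and `v` is a trace for the restrictions of `E`
  set W := commutantOrbit E v
  have hv : v ∈ W := mem_commutantOrbit.2 ⟨1, fun _ => Commute.one_right _, rfl⟩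
  have hEW : ∀ x, ∀ w ∈ W, E x w ∈ W := fun x w hw => by
    obtain ⟨T, hT, rfl⟩ := mem_commutantOrbit.1 hw
    refine mem_commutantOrbit.2 ⟨T * F x, fun y => (hT y).mul_right (hEF y x), ?_⟩
    rw [mul_apply_eq_comp, ← h1, ← mul_apply_eq_comp, ← (hT x).eq, mul_apply_eq_comp]
  have hFW : ∀ x, ∀ w ∈ W, F x w ∈ W := fun x w hw => by
    obtain ⟨T, hT, rfl⟩ := mem_commutantOrbit.1 hw
    exact mem_commutantOrbit.2 ⟨F x * T, fun y => (hEF y x).mul_right (hT y), rfl⟩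
  let E' : Fin 18 → Module.End ℂ W := fun x => (E x : H →ₗ[ℂ] H).restrict (hEW x)
  let F' : Fin 18 → Module.End ℂ W := fun x => (F x : H →ₗ[ℂ] H).restrict (hFW x)
  let A := Subalgebra.centralizer ℂ (Set.range F')
  have hE'A : ∀ x, E' x ∈ A := fun x => by
    rw [Subalgebra.mem_centralizer_iff]
    rintro _ ⟨y, rfl⟩
    ext w
    exact (congrArg (fun T : H →L[ℂ] H => T w) (hEF x y).eq).symm
  let P : Fin 18 → A := fun x => ⟨E' x, hE'A x⟩
  have hPv : ∀ x (w : W), (((P x : Module.End ℂ W) w : W) : H) = E x w := fun x w => rfl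
  let τ : A →ₗ[ℂ] ℂ :=
    { toFun := fun a => inner ℂ v (((a : Module.End ℂ W) ⟨v, hv⟩ : W) : H)
      map_add' := fun a b => by simp
      map_smul' := fun c a => by simp }
  obtain ⟨k1, k2⟩ := ks_trace P
    (fun x => by
      ext w
      exact apply_eq_of_mem_commutantOrbit w.2 (R := E x * E x) (S := E x)
        (fun T h => (h x).mul_left (h x)) (fun T h => h x) (idem x))
    (fun x y hxy => by
      ext w
      exact apply_eq_of_mem_commutantOrbit w.2 (R := E x * E y) (S := 0)
        (fun T h => (h x).mul_left (h y)) (fun T h => Commute.zero_left T) (orth x y hxy))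
    (fun i j => by
      ext w
      have h := apply_eq_of_mem_commutantOrbit w.2 (R := ∑ x ∈ ksBasis i j, E x) (S := 1)
        (fun T h => Commute.sum_left _ _ _ fun x _ => h x) (fun T h => Commute.one_left T)
        (by simpa using basis i j)
      simpa [hPv] using h)
    τ (fun x a => by
      have ha : ∀ w, F x ((a : Module.End ℂ W) w) = (a : Module.End ℂ W) (F' x w) := fun w => by
        have h := (Subalgebra.mem_centralizer_iff ℂ).1 a.2 (F' x) ⟨x, rfl⟩
        exact congrArg (fun T : Module.End ℂ W => ((T w : W) : H)) h
      have hs : ∀ (T : H →L[ℂ] H), IsSelfAdjoint T → ∀ y z, inner ℂ (T y) z = inner ℂ y (T z) :=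
        fun T hT => hT.isSymmetric
      have hv' : E' x ⟨v, hv⟩ = F' x ⟨v, hv⟩ := Subtype.ext (h1 x)
      calc τ (P x * a) = inner ℂ v (E x ((a : Module.End ℂ W) ⟨v, hv⟩ : W)) := rfl
        _ = inner ℂ v (F x ((a : Module.End ℂ W) ⟨v, hv⟩ : W)) := by
          rw [← hs _ (hE x), h1, hs _ (hF x)]
        _ = τ (a * P x) := by
          rw [ha, ← hv']
          rfl)
  have hone : τ 1 = inner ℂ v v := rfl
  rw [hone] at k1 k2
  refine ⟨k1, fun x y => ?_⟩
  rw [← h1, ← k2 x y]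
  rfl

lemma apply_eq_zero_of_re_inner {T : H →L[ℂ] H} (hT : 0 ≤ T)
    (h : (inner ℂ v (T v)).re = 0) : T v = 0 := by
  have hs : CFC.sqrt T * CFC.sqrt T = T := CFC.sqrt_mul_sqrt_self T hT
  have hsym : inner ℂ v (T v) = inner ℂ (CFC.sqrt T v) (CFC.sqrt T v) := by
    conv_lhs => rw [← hs, mul_apply_eq_comp]
    exact ((CFC.sqrt_nonneg T).isSelfAdjoint.isSymmetric v (CFC.sqrt T v)).symm
  rw [hsym] at h
  have h0 : CFC.sqrt T v = 0 := by
    rw [← norm_eq_zero, ← sq_eq_zero_iff, ← inner_self_eq_norm_sq (𝕜 := ℂ)]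
    exact h
  rw [← hs, mul_apply_eq_comp, h0, map_zero]

end Rigidity

namespace CommutingStrategy

variable {H : Type*} [NormedAddCommGroup H] [InnerProductSpace ℂ H] (S : CommutingStrategy H)

lemma re_expect_nonneg {T : H →L[ℂ] H} (hT : 0 ≤ T) : 0 ≤ (S.state.expect T).re :=
  S.state.re_expect_nonneg fun _ =>
    ((ContinuousLinearMap.nonneg_iff_isPositive T).1 hT).re_inner_nonneg_right _

lemma re_expect_mul_one_sub (x y : Fin 18) :
    (S.state.expect (S.alice x * (1 - S.bob y))).re = S.behavior.1 x - S.behavior.2.2 x y := by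
  simp [behavior, mul_sub, DensityOp.expect_sub]

lemma re_expect_one_sub_mul (x y : Fin 18) :
    (S.state.expect ((1 - S.alice x) * S.bob y)).re = S.behavior.2.1 y - S.behavior.2.2 x y := by
  simp [behavior, sub_mul, DensityOp.expect_sub]

lemma re_expect_one_sub_sum_ksBasis (i j : Fin 3) :
    (S.state.expect (1 - ∑ x ∈ ksBasis i j, S.alice x)).re =
      1 - ∑ x ∈ ksBasis i j, S.behavior.1 x := by
  simp [behavior, DensityOp.expect_sub, DensityOp.expect_sum, DensityOp.expect_one]

variable [CompleteSpace H]

lemma apply_vec_eq_zero {T : H →L[ℂ] H} (hT : 0 ≤ T) (h : (S.state.expect T).re = 0) (k : ℕ) :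
    T (S.state.vec k) = 0 :=
  apply_eq_zero_of_re_inner hT (S.state.re_inner_eq_zero (fun _ =>
    ((ContinuousLinearMap.nonneg_iff_isPositive T).1 hT).re_inner_nonneg_right _) h k)

lemma mul_nonneg (x y : Fin 18) : 0 ≤ S.alice x * S.bob y :=
  (S.commute x y).mul_nonneg (S.alice_effect x).nonneg (S.bob_effect y).nonneg

lemma mul_one_sub_nonneg (x y : Fin 18) : 0 ≤ S.alice x * (1 - S.bob y) :=
  ((Commute.one_right _).sub_right (S.commute x y)).mul_nonneg (S.alice_effect x).nonneg
    (S.bob_effect y).one_sub_nonneg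

lemma one_sub_mul_nonneg (x y : Fin 18) : 0 ≤ (1 - S.alice x) * S.bob y :=
  ((Commute.one_left _).sub_left (S.commute x y)).mul_nonneg (S.alice_effect x).one_sub_nonneg
    (S.bob_effect y).nonneg

lemma joint_nonneg (x y : Fin 18) : 0 ≤ S.behavior.2.2 x y :=
  S.re_expect_nonneg (S.mul_nonneg x y)

lemma joint_le_alice (x y : Fin 18) : S.behavior.2.2 x y ≤ S.behavior.1 x := by
  rw [← sub_nonneg, ← re_expect_mul_one_sub]
  exact S.re_expect_nonneg (S.mul_one_sub_nonneg x y)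

lemma joint_le_bob (x y : Fin 18) : S.behavior.2.2 x y ≤ S.behavior.2.1 y := by
  rw [← sub_nonneg, ← re_expect_one_sub_mul]
  exact S.re_expect_nonneg (S.one_sub_mul_nonneg x y)

end CommutingStrategy

/-- The face of the behaviours with perfectly correlated outcomes for equal settings, which never
give outcome 1 for two orthogonal vectors. -/
structure IsPerfect (p : Behavior) : Prop where
  joint_eq_alice : ∀ x, p.2.2 x x = p.1 x
  joint_eq_bob : ∀ x, p.2.2 x x = p.2.1 x
  joint_eq_zero : ∀ x y, ksDot x y = 0 → p.2.2 x y = 0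

namespace CommutingStrategy

variable {H : Type*} [NormedAddCommGroup H] [InnerProductSpace ℂ H] [CompleteSpace H]
  {S : CommutingStrategy H} (hS : IsPerfect S.behavior)
include hS

lemma alice_vec_eq_bob_vec (x : Fin 18) (k : ℕ) :
    S.alice x (S.state.vec k) = S.bob x (S.state.vec k) := by
  have h1 := S.apply_vec_eq_zero (S.mul_one_sub_nonneg x x)
    (by rw [re_expect_mul_one_sub, hS.joint_eq_alice, sub_self]) k
  have h2 := S.apply_vec_eq_zero (S.one_sub_mul_nonneg x x)
    (by rw [re_expect_one_sub_mul, hS.joint_eq_bob, sub_self]) k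
  rw [mul_sub, mul_one, _root_.sub_apply, sub_eq_zero] at h1
  rw [sub_mul, one_mul, _root_.sub_apply, sub_eq_zero] at h2
  rw [h1, h2]

lemma alice_alice_vec (x : Fin 18) (k : ℕ) :
    S.alice x (S.alice x (S.state.vec k)) = S.alice x (S.state.vec k) := by
  have h1 := S.apply_vec_eq_zero (S.mul_one_sub_nonneg x x)
    (by rw [re_expect_mul_one_sub, hS.joint_eq_alice, sub_self]) k
  rw [mul_sub, mul_one, _root_.sub_apply, sub_eq_zero, mul_apply_eq_comp,
    ← alice_vec_eq_bob_vec hS] at h1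
  exact h1.symm

lemma alice_alice_vec_eq_zero {x y : Fin 18} (hxy : ksDot x y = 0) (k : ℕ) :
    S.alice x (S.alice y (S.state.vec k)) = 0 := by
  rw [alice_vec_eq_bob_vec hS, ← mul_apply_eq_comp]
  exact S.apply_vec_eq_zero (S.mul_nonneg x y) (hS.joint_eq_zero x y hxy) k

/-- On the state, the sum of the effects of a basis acts as a projection. -/
lemma re_inner_one_sub_sum_ksBasis (i j : Fin 3) (k : ℕ) :
    (inner ℂ (S.state.vec k) ((1 - ∑ x ∈ ksBasis i j, S.alice x) (S.state.vec k))).re =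
      ‖(1 - ∑ x ∈ ksBasis i j, S.alice x) (S.state.vec k)‖ ^ 2 := by
  set D := 1 - ∑ x ∈ ksBasis i j, S.alice x with hD
  have hsa : IsSelfAdjoint D :=
    (IsSelfAdjoint.one _).sub (isSelfAdjoint_sum _ fun x _ => (S.alice_effect x).isSelfAdjoint)
  have hx : ∀ x ∈ ksBasis i j, S.alice x (D (S.state.vec k)) = 0 := fun x hx => by
    rw [hD, _root_.sub_apply, one_apply_eq_self, _root_.sum_apply, map_sub, map_sum,
      Finset.sum_eq_single_of_mem x hx fun y hy hyx =>
        alice_alice_vec_eq_zero hS (ksDot_of_mem_ksBasis hx hy hyx.symm) k,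
      alice_alice_vec hS, sub_self]
  have hDD : D (D (S.state.vec k)) = D (S.state.vec k) := by
    conv_lhs => rw [hD]
    rw [_root_.sub_apply, one_apply_eq_self, _root_.sum_apply, Finset.sum_eq_zero hx, sub_zero]
  have h := hsa.isSymmetric (S.state.vec k) (D (S.state.vec k))
  simp only [ContinuousLinearMap.coe_coe] at h
  rw [hDD] at h
  rw [← inner_self_eq_norm_sq (𝕜 := ℂ), h]
  rfl

lemma sum_ksBasis_le_one (i j : Fin 3) : ∑ x ∈ ksBasis i j, S.behavior.1 x ≤ 1 := by
  rw [← sub_nonneg, ← re_expect_one_sub_sum_ksBasis]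
  refine S.state.re_expect_nonneg fun _ => ?_
  rw [re_inner_one_sub_sum_ksBasis hS]
  positivity

lemma sum_ksBasis_vec {i j : Fin 3} (h : ∑ x ∈ ksBasis i j, S.behavior.1 x = 1) (k : ℕ) :
    ∑ x ∈ ksBasis i j, S.alice x (S.state.vec k) = S.state.vec k := by
  have h1 := S.state.re_inner_eq_zero (T := 1 - ∑ x ∈ ksBasis i j, S.alice x) (fun k => by
    rw [re_inner_one_sub_sum_ksBasis hS]
    positivity) (by rw [re_expect_one_sub_sum_ksBasis, h, sub_self]) k
  rw [re_inner_one_sub_sum_ksBasis hS, sq_eq_zero_iff, norm_eq_zero, _root_.sub_apply,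
    one_apply_eq_self, _root_.sum_apply, sub_eq_zero] at h1
  exact h1.symm

/-- Perfect behaviours that are complete on each of the nine bases are the KS18 correlations. -/
theorem behavior_eq_ksBehavior (h : ∀ i j, ∑ x ∈ ksBasis i j, S.behavior.1 x = 1) :
    S.behavior = ksBehavior := by
  have key := fun k => ks_rigidity (v := S.state.vec k)
    (fun x => (S.alice_effect x).isSelfAdjoint) (fun x => (S.bob_effect x).isSelfAdjoint) S.commute
    (fun x => alice_vec_eq_bob_vec hS x k) (fun x => alice_alice_vec hS x k)
    (fun x y hxy => alice_alice_vec_eq_zero hS hxy k) (fun i j => sum_ksBasis_vec hS (h i j) k)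
  have hexp : ∀ (T : H →L[ℂ] H) (c : ℂ), (∀ k, inner ℂ (S.state.vec k) (T (S.state.vec k)) =
      c * inner ℂ (S.state.vec k) (S.state.vec k)) → S.state.expect T = c := fun T c hT => by
    have h1 : S.state.expect T = S.state.expect (c • 1) := by
      rw [DensityOp.expect, DensityOp.expect]
      exact tsum_congr fun k => by simp [hT]
    rw [h1, DensityOp.expect_smul, DensityOp.expect_one, mul_one]
  have hA : ∀ x, S.behavior.1 x = 1 / 4 := fun x => by
    have h1 := hexp (S.alice x) (1 / 4) fun k => (key k).1 x
    simp only [behavior]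
    rw [h1]
    norm_num
  refine Prod.ext (funext fun x => ?_) (Prod.ext (funext fun y => ?_)
    (funext fun x => funext fun y => ?_))
  · rw [hA, ksBehavior_alice]
  · rw [← hS.joint_eq_bob, hS.joint_eq_alice, hA, ksBehavior_bob]
  · rw [ksBehavior_joint]
    have h2 := hexp (S.alice x * S.bob y) _ fun k => (key k).2 x y
    have h3 : (ksDot x y ^ 2 / (4 * ksNormSq x * ksNormSq y) : ℂ) =
        ((ksDot x y ^ 2 / (4 * ksNormSq x * ksNormSq y) : ℝ) : ℂ) := by push_cast; rfl
    simp only [behavior]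
    rw [h2, h3, Complex.ofReal_re]

end CommutingStrategy

lemma isPerfect_ksBehavior : IsPerfect ksBehavior where
  joint_eq_alice x := by
    have h : ksDot x x = ksNormSq x := Finset.sum_congr rfl fun r _ => (sq _).symm
    have h0 : (ksNormSq x : ℝ) ≠ 0 := by exact_mod_cast (ksNormSq_pos x).ne'
    rw [ksBehavior_joint, ksBehavior_alice, h]
    field_simp
  joint_eq_bob x := by
    have h : ksDot x x = ksNormSq x := Finset.sum_congr rfl fun r _ => (sq _).symm
    have h0 : (ksNormSq x : ℝ) ≠ 0 := by exact_mod_cast (ksNormSq_pos x).ne'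
    rw [ksBehavior_joint, ksBehavior_bob, h]
    field_simp
  joint_eq_zero x y h := by simp [ksBehavior_joint, h]

lemma eq_zero_of_convex_comb {a b s t : ℝ} (ha : 0 < a) (hb : 0 < b) (hs : 0 ≤ s) (ht : 0 ≤ t)
    (h : a * s + b * t = 0) : s = 0 := by
  have h1 := mul_nonneg ha.le hs
  have h2 := mul_nonneg hb.le ht
  exact (mul_eq_zero.1 (le_antisymm (by linarith) h1)).resolve_left ha.ne'

/-- The conditions of `IsPerfect` are equality cases of inequalities that hold on the quantum set, so
they are inherited by the endpoints of a segment through `ksBehavior`. -/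
lemma isPerfect_of_mem_openSegment {p q : Behavior} (hp : p ∈ commutingQuantumSet.{u})
    (hq : q ∈ commutingQuantumSet.{u}) (h : ksBehavior ∈ openSegment ℝ p q) : IsPerfect p := by
  obtain ⟨H, _, _, _, S, rfl⟩ := hp
  obtain ⟨K, _, _, _, T, rfl⟩ := hq
  obtain ⟨a, b, ha, hb, -, hab⟩ := h
  have hA : ∀ x, a * S.behavior.1 x + b * T.behavior.1 x = ksBehavior.1 x := fun x =>
    congrArg (fun p : Behavior => p.1 x) hab
  have hB : ∀ x, a * S.behavior.2.1 x + b * T.behavior.2.1 x = ksBehavior.2.1 x := fun x =>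
    congrArg (fun p : Behavior => p.2.1 x) hab
  have hAB : ∀ x y, a * S.behavior.2.2 x y + b * T.behavior.2.2 x y = ksBehavior.2.2 x y :=
    fun x y => congrArg (fun p : Behavior => p.2.2 x y) hab
  have hks := isPerfect_ksBehavior
  refine ⟨fun x => ?_, fun x => ?_, fun x y hxy => ?_⟩
  · have := eq_zero_of_convex_comb ha hb (sub_nonneg.2 (S.joint_le_alice x x))
      (sub_nonneg.2 (T.joint_le_alice x x))
      (by linear_combination hA x - hAB x x - hks.joint_eq_alice x)
    linarith
  · have := eq_zero_of_convex_comb ha hb (sub_nonneg.2 (S.joint_le_bob x x))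
      (sub_nonneg.2 (T.joint_le_bob x x))
      (by linear_combination hB x - hAB x x - hks.joint_eq_bob x)
    linarith
  · exact eq_zero_of_convex_comb ha hb (S.joint_nonneg x y) (T.joint_nonneg x y)
      (by rw [hAB, hks.joint_eq_zero x y hxy])

theorem ksBehavior_mem_extremePoints :
    ksBehavior ∈ Set.extremePoints ℝ commutingQuantumSet.{u} := by
  refine ⟨tensorQuantumSet_subset_commutingQuantumSet
    (finiteQuantumSet_subset_tensorQuantumSet ksBehavior_mem_finiteQuantumSet),
    fun p hp q hq h => ?_⟩
  have hpp := isPerfect_of_mem_openSegment hp hq h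
  have hqp := isPerfect_of_mem_openSegment hq hp (openSegment_symm ℝ p q ▸ h)
  obtain ⟨H, _, _, _, S, rfl⟩ := hp
  obtain ⟨K, _, _, _, T, rfl⟩ := hq
  obtain ⟨a, b, ha, hb, hab1, hab⟩ := h
  refine CommutingStrategy.behavior_eq_ksBehavior hpp fun i j => ?_
  have hA : ∀ x, a * S.behavior.1 x + b * T.behavior.1 x = ksBehavior.1 x := fun x =>
    congrArg (fun p : Behavior => p.1 x) hab
  have hsum : a * ∑ x ∈ ksBasis i j, S.behavior.1 x + b * ∑ x ∈ ksBasis i j, T.behavior.1 x = 1 := by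
    rw [Finset.mul_sum, Finset.mul_sum, ← Finset.sum_add_distrib]
    simp [hA, ksBehavior_alice, card_ksBasis]
  have := eq_zero_of_convex_comb ha hb
    (sub_nonneg.2 (CommutingStrategy.sum_ksBasis_le_one hpp i j))
    (sub_nonneg.2 (CommutingStrategy.sum_ksBasis_le_one hqp i j))
    (by linear_combination hab1 - hsum)
  linarith

/-! ### The boundary -/

lemma bellT_add_smul (p δ : Behavior) (t : ℝ) : bellT (p + t • δ) = bellT p + t * bellT δ := by
  simp only [bellT, bellValue, Pi.zero_apply, zero_mul, Finset.sum_const_zero, add_zero,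
    Prod.snd_add, Prod.smul_snd, Pi.add_apply, Pi.smul_apply, smul_eq_mul, mul_add,
    Finset.sum_add_distrib, Finset.mul_sum]
  congr 1
  refine Finset.sum_congr rfl fun x _ => Finset.sum_congr rfl fun y _ => ?_
  ring

/-- A maximizer of the nonzero linear functional `bellT` is not an interior point. -/
lemma mem_frontier_of_bellT_le {Q : Set Behavior} {p : Behavior} (hp : p ∈ Q)
    (h : ∀ q ∈ Q, bellT q ≤ bellT p) (h0 : 0 < bellT p) : p ∈ frontier Q := by
  refine ⟨subset_closure hp, fun hint => ?_⟩
  have hc : Filter.Tendsto (fun t : ℝ => p + t • p) (nhds 0) (nhds p) := by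
    have : Continuous fun t : ℝ => p + t • p := by fun_prop
    simpa using this.tendsto 0
  have hev := hc.eventually (mem_interior_iff_mem_nhds.1 hint)
  obtain ⟨t, ht, ht0⟩ := ((hev.filter_mono nhdsWithin_le_nhds).and
    (self_mem_nhdsWithin (s := Set.Ioi (0 : ℝ)))).exists
  have h1 := h _ ht
  rw [bellT_add_smul] at h1
  have := mul_pos (Set.mem_Ioi.1 ht0) h0
  linarith

end KS18

end

theorem mainTheorem2 :
    IsGreatest (KS18.bellT '' KS18.npaSet) (45 / 4) ∧
    KS18.bellT KS18.ksBehavior = 45 / 4 ∧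
    ∀ Q ∈ ({KS18.finiteQuantumSet.{u}, KS18.tensorQuantumSet.{u}, KS18.commutingQuantumSet.{u}} :
        Set (Set KS18.Behavior)),
      KS18.ksBehavior ∈ Q ∧
      IsGreatest (KS18.bellT '' Q) (45 / 4) ∧
      KS18.ksBehavior ∈ frontier Q ∧
      KS18.ksBehavior ∈ Set.extremePoints ℝ Q := by
  have hsub : ∀ Q : Set KS18.Behavior, KS18.ksBehavior ∈ Q → Q ⊆ KS18.npaSet →
      IsGreatest (KS18.bellT '' Q) (45 / 4) := fun Q hks hQ =>
    ⟨⟨_, hks, KS18.bellT_ksBehavior⟩, by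
      rintro _ ⟨p, hp, rfl⟩
      exact KS18.bellT_le_of_mem_npaSet (hQ hp)⟩
  have hfin := KS18.ksBehavior_mem_finiteQuantumSet.{u}
  have hten := KS18.finiteQuantumSet_subset_tensorQuantumSet.{u} hfin
  have hcom := KS18.tensorQuantumSet_subset_commutingQuantumSet.{u} hten
  have hnpa := KS18.commutingQuantumSet_subset_npaSet.{u}
  refine ⟨hsub _ (hnpa hcom) subset_rfl, KS18.bellT_ksBehavior, fun Q hQ => ?_⟩
  have hQ' : KS18.ksBehavior ∈ Q ∧ Q ⊆ KS18.commutingQuantumSet.{u} := by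
    rcases hQ with rfl | rfl | rfl
    · exact ⟨hfin, KS18.finiteQuantumSet_subset_tensorQuantumSet.trans
        KS18.tensorQuantumSet_subset_commutingQuantumSet⟩
    · exact ⟨hten, KS18.tensorQuantumSet_subset_commutingQuantumSet⟩
    · exact ⟨hcom, subset_rfl⟩
  obtain ⟨hks, hQc⟩ := hQ'
  refine ⟨hks, hsub Q hks (hQc.trans hnpa), ?_, ?_⟩
  · refine KS18.mem_frontier_of_bellT_le hks (fun q hq => ?_) ?_
    · rw [KS18.bellT_ksBehavior]
      exact KS18.bellT_le_of_mem_npaSet (hnpa (hQc hq))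
    · rw [KS18.bellT_ksBehavior]
      norm_num
  · exact inter_extremePoints_subset_extremePoints_of_subset hQc
      ⟨hks, KS18.ksBehavior_mem_extremePoints⟩
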